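/- A pseudoline arrangement is a finite set of bi-infinite $x$-monotone curves in the Euclidean plane (graphs of continuous functions $\mathbb R\to\mathbb R$), any two of which meet in exactly one point and cross there; it is simple if no three of the curves have a common point. Its faces are the connected components of the complement of the union of the curves, and its edges are the connected components of the curves minus the crossing points. A dual path is a sequence of pairwise distinct faces in which any two consecutive faces share an edge; its length is its number of faces. If every pseudoline is colored red or blue, each edge gets the color of the pseudoline containing it, and a dual path is alternating if no two consecutive shared edges have the same color. **Theorem (Random Bicolorings).** There is an absolute constant $c>0$ such that the following holds. (1) Color each pseudoline of a simple arrangement of $n$ pseudolines red or blue independently with probability $1/2$ each. Then, with high probability, there is an alternating dual path of length at least $c\,n^2/\log n$; that is, for every $\varepsilon>0$ there is an $N$ such that for all $n\ge N$ and every simple arrangement of $n$ pseudolines, this happens with probability at least $1-\varepsilon$. (2) Consequently, for every $n\ge 2$, every simple arrangement of $n$ pseudolines has a coloring of its pseudolines in which both colors occur and which admits an alternating dual path of length at least $c\,n^2/\log n$. -/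

import Mathlib

/-- The graphs of `f` and `g` meet in exactly one point, and there
they cross: the curve that is below to the left of the point is above to the right of it. -/
def CrossExactlyOnce (f g : ℝ → ℝ) : Prop :=
  ∃ x₀ : ℝ, f x₀ = g x₀ ∧
    (((∀ x, x < x₀ → f x < g x) ∧ (∀ x, x₀ < x → g x < f x)) ∨
     ((∀ x, x < x₀ → g x < f x) ∧ (∀ x, x₀ < x → f x < g x)))

/-- A Euclidean arrangement of `n` pseudolines: `n` bi-infinite `x`-monotone curves in the plane
(graphs of continuous functions `ℝ → ℝ`), any two of which cross exactly once. -/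
structure PseudolineArrangement (n : ℕ) where
  /-- the function whose graph is the `i`-th pseudoline -/
  curve : Fin n → ℝ → ℝ
  continuous_curve : ∀ i, Continuous (curve i)
  cross : ∀ i j, i ≠ j → CrossExactlyOnce (curve i) (curve j)

/-- `C` is a connected component of the subset `S` of the plane. -/
def IsComponentOf (S C : Set (ℝ × ℝ)) : Prop :=
  ∃ p ∈ S, C = connectedComponentIn S p

namespace PseudolineArrangement

/-- No three pseudolines have a common point. -/
def IsSimple {n : ℕ} (A : PseudolineArrangement n) : Prop :=
  ∀ i j k : Fin n, i ≠ j → j ≠ k → i ≠ k →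
    ∀ x : ℝ, ¬ (A.curve i x = A.curve j x ∧ A.curve j x = A.curve k x)

/-- The `i`-th pseudoline as a set of points. -/
def line {n : ℕ} (A : PseudolineArrangement n) (i : Fin n) : Set (ℝ × ℝ) :=
  {p | p.2 = A.curve i p.1}

/-- The faces: connected components of the complement of the union of all pseudolines. -/
def IsFace {n : ℕ} (A : PseudolineArrangement n) (F : Set (ℝ × ℝ)) : Prop :=
  IsComponentOf (⋃ i, A.line i)ᶜ F

/-- The edges on the `i`-th pseudoline: the connected components of what is left of it after
removing its crossings with the other pseudolines. -/
def IsEdge {n : ℕ} (A : PseudolineArrangement n) (i : Fin n) (e : Set (ℝ × ℝ)) : Prop :=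
  IsComponentOf (A.line i \ ⋃ j ∈ {j : Fin n | j ≠ i}, A.line j) e

/-- `F 0, …, F k` is a dual path: pairwise distinct faces, where `F j` and `F (j + 1)` share the
edge `e j`, which lies on pseudoline `ℓ j`. -/
structure IsDualPath {n : ℕ} (A : PseudolineArrangement n) {k : ℕ}
    (F : Fin (k + 1) → Set (ℝ × ℝ)) (ℓ : Fin k → Fin n) (e : Fin k → Set (ℝ × ℝ)) : Prop where
  isFace : ∀ j, A.IsFace (F j)
  injective : Function.Injective F
  isEdge : ∀ j, A.IsEdge (ℓ j) (e j)
  subset_left : ∀ j, e j ⊆ closure (F j.castSucc)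
  subset_right : ∀ j, e j ⊆ closure (F j.succ)

/-- In the coloring `χ` of the pseudolines (`true` for red, `false` for blue) there is an
alternating dual path, that is, one in which no two consecutive edges have the same color, of
length at least `L`. The length of a dual path is its number of faces. -/
def HasAlternatingPath {n : ℕ} (A : PseudolineArrangement n) (χ : Fin n → Bool) (L : ℝ) : Prop :=
  ∃ (k : ℕ) (F : Fin (k + 1) → Set (ℝ × ℝ)) (ℓ : Fin k → Fin n) (e : Fin k → Set (ℝ × ℝ)),
    A.IsDualPath F ℓ e ∧
    (∀ i j : Fin k, (j : ℕ) = (i : ℕ) + 1 → χ (ℓ i) ≠ χ (ℓ j)) ∧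
    L ≤ (k : ℝ) + 1

end PseudolineArrangement

/-- The uniform probability measure on the `2 ^ n` red/blue colorings of `n` pseudolines: every
pseudoline is red or blue with probability `1 / 2` each, independently of the others. -/
noncomputable def randomColoring (n : ℕ) : MeasureTheory.Measure (Fin n → Bool) :=
  (PMF.uniformOfFintype (Fin n → Bool)).toMeasure

/-! The pseudolines are swept from left to right: a `Wiring` records their vertical order in a
sequence of columns at abscissae on either side of the crossings, and a face is represented by the
set `below t k` of the pseudolines below it.

Orient the dual graph by letting red edges be crossed from faces with an even number of pseudolines
below them and blue edges from faces with an odd number (`Wiring.Step`). Each step changes that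
parity, so directed walks are alternating, and since the state of a walk is determined by
its face, loops can be erased (`Relation.ReflTransGen.exists_path`): it suffices to construct
directed walks. The four faces around a crossing of a red and a blue pseudoline form a directed
cycle (`Wiring.linked_of_crossing`).

Two gaps of a column whose bounding lines differ in color lead to the same strongly connected
component (`Wiring.IsBi.linked`). Between two consecutive such gaps there is a run of, say, red
lines with blue lines below and above. This run is a slice of a face of the blue subarrangement, and
it can be followed to the left and to the right along the blue lines bounding it. All crossings met
there with red lines are bichromatic, so the faces along one boundary remain linked, and the
two boundaries meet at the end of the blue face. An end exists on one side, because each two blue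
lines cross.

All faces visited here are separated by red lines only. The coloring is `Mixed` if fewer than
`m` lines separate two faces in one direction whenever these lines all have the same color. There
are polynomially many pairs of faces, so by a union bound a random coloring is mixed with high
probability for some `m` of order `log n` (`Wiring.card_not_mixed_le`), and then the walks above stay
within distance `O(m)`.

Therefore the strongly connected walks can be confined to a snake that runs to and fro through
about `n / log n` strips of `O(log n)` consecutive levels. The middle levels have to cross linearly
many lines between the left and the right end of the arrangement, so a suitable potential
(`snake`) that grows by at most one in each step increases by `n / 8` in each strip. Hence any
directed path from the first strip to the last has length of order `n ^ 2 / log n`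
(`Wiring.Mixed.exists_long_path`).

On the geometric side, the sets of points with a given nonempty sign vector are the faces
(`PseudolineArrangement.isFace_cell`), and consecutive gaps of a column share an edge
(`PseudolineArrangement.exists_isEdge`). -/

/-! ### Wiring diagrams and the oriented dual graph -/

/-- A combinatorial wiring diagram of `n` pseudolines: the vertical order of the lines in a
sequence of columns. `pos t i` is the number of lines below line `i` in column `t`. From column
`T` on the order is constant. Since `pos t` is a bijection onto `{0, …, n - 1}`, the
condition `step_le` says that consecutive columns differ by disjoint swaps of neighbours; several
swaps may occur in one step. -/
structure Wiring (n : ℕ) where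
  /-- the index of the last column -/
  T : ℕ
  /-- the position of a line in a column, counted from below -/
  pos : ℕ → Fin n → ℕ
  pos_lt : ∀ t i, pos t i < n
  inj : ∀ t, Function.Injective (pos t)
  step_le : ∀ t i, pos (t + 1) i ≤ pos t i + 1 ∧ pos t i ≤ pos (t + 1) i + 1
  stable : ∀ t, T ≤ t → pos t = pos T
  rev : ∀ i j, pos 0 i < pos 0 j → pos T j < pos T i

/-- Two sets of lines differ by at most `r` elements in either direction. -/
def Near {α : Type*} [DecidableEq α] (r : ℕ) (X Y : Finset α) : Prop :=
  (Y \ X).card ≤ r ∧ (X \ Y).card ≤ r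

theorem Near.refl {α : Type*} [DecidableEq α] (r : ℕ) (X : Finset α) : Near r X X := by
  simp [Near]

theorem Near.symm {α : Type*} [DecidableEq α] {r : ℕ} {X Y : Finset α} (h : Near r X Y) :
    Near r Y X := ⟨h.2, h.1⟩

theorem Near.mono {α : Type*} [DecidableEq α] {r s : ℕ} {X Y : Finset α} (h : Near r X Y)
    (hrs : r ≤ s) : Near s X Y := ⟨h.1.trans hrs, h.2.trans hrs⟩

theorem Near.trans {α : Type*} [DecidableEq α] {r s : ℕ} {X Y Z : Finset α} (h : Near r X Y)
    (h' : Near s Y Z) : Near (r + s) X Z := by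
  have key : ∀ A B C : Finset α, (A \ C).card ≤ (A \ B).card + (B \ C).card := by
    intro A B C
    refine (Finset.card_le_card ?_).trans (Finset.card_union_le _ _)
    intro a
    simp only [Finset.mem_sdiff, Finset.mem_union]
    tauto
  have h1 := key Z Y X
  have h2 := key X Y Z
  obtain ⟨h3, h4⟩ := h
  obtain ⟨h5, h6⟩ := h'
  exact ⟨by omega, by omega⟩

/-- The relations `a → b → c → d → a` make all of `a`, `b`, `c`, `d` reachable from each other. -/
theorem reflTransGen_of_fourCycle {α : Type*} {R : α → α → Prop} {a b c d : α}
    (hab : R a b) (hbc : R b c) (hcd : R c d) (hda : R d a) {x y : α}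
    (hx : x = a ∨ x = b ∨ x = c ∨ x = d) (hy : y = a ∨ y = b ∨ y = c ∨ y = d) :
    Relation.ReflTransGen R x y := by
  have hab := Relation.ReflTransGen.single hab
  have hbc := Relation.ReflTransGen.single hbc
  have hcd := Relation.ReflTransGen.single hcd
  have hda := Relation.ReflTransGen.single hda
  have toA : Relation.ReflTransGen R x a := by
    rcases hx with rfl | rfl | rfl | rfl
    · exact .refl
    · exact (hbc.trans hcd).trans hda
    · exact hcd.trans hda
    · exact hda
  refine toA.trans ?_
  rcases hy with rfl | rfl | rfl | rfl
  · exact .refl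
  · exact hab
  · exact hab.trans hbc
  · exact (hab.trans hbc).trans hcd

namespace Wiring

variable {n : ℕ} (w : Wiring n)

/-- The set of the lines below gap `k` of column `t`. A face of the arrangement is represented by
the set of lines below it. -/
def below (t k : ℕ) : Finset (Fin n) := Finset.univ.filter fun i => w.pos t i < k

variable {w}

@[simp] theorem mem_below {t k : ℕ} {i : Fin n} : i ∈ w.below t k ↔ w.pos t i < k := by
  simp [below]

theorem image_pos (t : ℕ) : Finset.univ.image (w.pos t) = Finset.range n := by
  apply Finset.eq_of_subset_of_card_le
  · intro k hk
    obtain ⟨i, -, rfl⟩ := Finset.mem_image.1 hk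
    exact Finset.mem_range.2 (w.pos_lt t i)
  · rw [Finset.card_image_of_injective _ (w.inj t)]; simp

theorem exists_pos_eq (t : ℕ) {k : ℕ} (hk : k < n) : ∃ i, w.pos t i = k := by
  have : k ∈ Finset.univ.image (w.pos t) := by rw [image_pos]; exact Finset.mem_range.2 hk
  simpa using this

theorem card_below (t : ℕ) {k : ℕ} (hk : k ≤ n) : (w.below t k).card = k := by
  have : (w.below t k).image (w.pos t) = Finset.range k := by
    ext a
    simp only [Finset.mem_image, mem_below, Finset.mem_range]
    constructor
    · rintro ⟨i, hi, rfl⟩; exact hi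
    · intro ha
      obtain ⟨i, rfl⟩ := w.exists_pos_eq t (lt_of_lt_of_le ha hk)
      exact ⟨i, ha, rfl⟩
  rw [← Finset.card_image_of_injective _ (w.inj t), this, Finset.card_range]

theorem below_of_le (t : ℕ) {k : ℕ} (hk : n ≤ k) : w.below t k = w.below t n := by
  ext i
  have := w.pos_lt t i
  simp only [mem_below]; omega

theorem card_below_eq (t s k : ℕ) : (w.below t k).card = (w.below s k).card := by
  rcases le_total k n with h | h
  · rw [card_below t h, card_below s h]
  · rw [below_of_le t h, below_of_le s h, card_below t le_rfl, card_below s le_rfl]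

/-- A line that moves up changes places with the line above it. -/
theorem swap_of_up {t k : ℕ} {i : Fin n} (h : w.pos t i < k) (h' : k ≤ w.pos (t + 1) i) :
    ∃ j, w.pos t j = k ∧ w.pos (t + 1) j + 1 = k := by
  have hne : (w.below (t + 1) k \ w.below t k).Nonempty := by
    rw [← Finset.card_pos, Finset.card_sdiff_comm (card_below_eq _ _ _), Finset.card_pos]
    exact ⟨i, by simp [h, h']⟩
  obtain ⟨j, hj⟩ := hne
  simp only [Finset.mem_sdiff, mem_below] at hj
  have := w.step_le t j
  exact ⟨j, by omega, by omega⟩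

/-- A line that moves down changes places with the line below it. -/
theorem swap_of_down {t k : ℕ} {j : Fin n} (h : k ≤ w.pos t j) (h' : w.pos (t + 1) j < k) :
    ∃ i, w.pos t i + 1 = k ∧ w.pos (t + 1) i = k := by
  have hne : (w.below t k \ w.below (t + 1) k).Nonempty := by
    rw [← Finset.card_pos, Finset.card_sdiff_comm (card_below_eq _ _ _), Finset.card_pos]
    exact ⟨j, by simp [h, h']⟩
  obtain ⟨i, hi⟩ := hne
  simp only [Finset.mem_sdiff, mem_below] at hi
  have := w.step_le t i
  exact ⟨i, by omega, by omega⟩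

/-- A gap that is not closed by a crossing belongs to the same face in the next column. -/
theorem below_succ_eq {t k : ℕ} (h : ∀ i, w.pos t i + 1 = k → w.pos (t + 1) i ≠ k) :
    w.below (t + 1) k = w.below t k := by
  ext i
  simp only [mem_below]
  constructor <;> intro hi <;> by_contra hc
  · obtain ⟨j, h1, h2⟩ := swap_of_down (not_lt.1 hc) hi
    exact h j h1 h2
  · have := w.step_le t i
    exact h i (by omega) (by omega)

theorem below_succ_eq_insert {t : ℕ} (i : Fin n) :
    w.below t (w.pos t i + 1) = insert i (w.below t (w.pos t i)) := by
  ext j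
  simp only [mem_below, Finset.mem_insert]
  constructor
  · intro h
    rcases Nat.lt_succ_iff_lt_or_eq.1 h with h | h
    · exact Or.inr h
    · exact Or.inl (w.inj t h)
  · rintro (rfl | h) <;> omega

/-- The faces `X` and `Y` are separated by an edge on line `i`, with `X` below. -/
def Across (w : Wiring n) (i : Fin n) (X Y : Finset (Fin n)) : Prop :=
  ∃ t, X = w.below t (w.pos t i) ∧ Y = w.below t (w.pos t i + 1)

/-- The dual graph, oriented according to the coloring: red edges are crossed from faces with an
even number of lines below, blue edges from the other faces. Each crossing changes this parity, so
directed walks are alternating. -/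
def Step (w : Wiring n) (χ : Fin n → Bool) (X Y : Finset (Fin n)) : Prop :=
  ∃ i, (w.Across i X Y ∨ w.Across i Y X) ∧ (χ i = true ↔ Even X.card)

theorem Across.eq_insert {i : Fin n} {X Y : Finset (Fin n)} (h : w.Across i X Y) :
    i ∉ X ∧ Y = insert i X := by
  obtain ⟨t, rfl, rfl⟩ := h
  exact ⟨by simp, below_succ_eq_insert i⟩

theorem Step.insert {χ : Fin n → Bool} {X Y : Finset (Fin n)} (h : w.Step χ X Y) :
    ∃ i, (i ∉ X ∧ Y = Insert.insert i X) ∨ (i ∉ Y ∧ X = Insert.insert i Y) := by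
  obtain ⟨i, h | h, -⟩ := h
  · exact ⟨i, Or.inl h.eq_insert⟩
  · exact ⟨i, Or.inr h.eq_insert⟩

/-- `X` and `Y` lie in the same strongly connected component of the part of the oriented dual graph
that is formed by the faces with property `P`. -/
def Linked (w : Wiring n) (χ : Fin n → Bool) (P : Finset (Fin n) → Prop)
    (X Y : Finset (Fin n)) : Prop :=
  Relation.ReflTransGen (fun X Y => P X ∧ P Y ∧ w.Step χ X Y) X Y ∧
    Relation.ReflTransGen (fun X Y => P X ∧ P Y ∧ w.Step χ X Y) Y X

variable {χ : Fin n → Bool} {P : Finset (Fin n) → Prop}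

theorem Linked.refl (X : Finset (Fin n)) : w.Linked χ P X X := ⟨.refl, .refl⟩

theorem Linked.symm {X Y : Finset (Fin n)} (h : w.Linked χ P X Y) : w.Linked χ P Y X :=
  ⟨h.2, h.1⟩

theorem Linked.trans {X Y Z : Finset (Fin n)} (h : w.Linked χ P X Y) (h' : w.Linked χ P Y Z) :
    w.Linked χ P X Z := ⟨h.1.trans h'.1, h'.2.trans h.2⟩

theorem near_below (t k : ℕ) {l r : ℕ} (h : k ≤ l + r) (h' : l ≤ k + r) :
    Near r (w.below t k) (w.below t l) := by
  have key : ∀ a b, a ≤ b + r → (w.below t a \ w.below t b).card ≤ r := by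
    intro a b hab
    calc _ ≤ (Finset.Ico b a).card := by
          refine Finset.card_le_card_of_injOn (w.pos t) ?_ (w.inj t).injOn
          intro i hi
          simp only [Finset.coe_sdiff, Set.mem_sdiff, Finset.mem_coe, mem_below] at hi
          simp only [Finset.coe_Ico, Set.mem_Ico]; omega
      _ ≤ r := by simp; omega
  exact ⟨key l k h', key k l h⟩

/-- The four faces around a crossing of a red and a blue line form a directed cycle. -/
theorem linked_of_crossing {t k : ℕ} {i j : Fin n} (hi : w.pos t i = k)
    (hi' : w.pos (t + 1) i = k + 1) (hj : w.pos t j = k + 1) (hj' : w.pos (t + 1) j = k)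
    (hij : χ i ≠ χ j)
    (hP : ∀ X, Near 2 (w.below t (k + 1)) X → P X) {X Y : Finset (Fin n)}
    (hX : X = w.below t k ∨ X = w.below t (k + 1) ∨ X = w.below t (k + 2) ∨
      X = w.below (t + 1) (k + 1))
    (hY : Y = w.below t k ∨ Y = w.below t (k + 1) ∨ Y = w.below t (k + 2) ∨
      Y = w.below (t + 1) (k + 1)) :
    w.Linked χ P X Y := by
  have hk : k + 1 < n := hj ▸ w.pos_lt t j
  have e0 : w.below (t + 1) k = w.below t k := by
    apply below_succ_eq
    intro l hl hl'
    have : l = j := w.inj _ (hl'.trans hj'.symm)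
    subst this; omega
  have e2 : w.below (t + 1) (k + 2) = w.below t (k + 2) := by
    apply below_succ_eq
    intro l hl hl'
    have : l = j := w.inj _ (by omega : w.pos t l = w.pos t j)
    subst this; omega
  have c0 := w.card_below t (k := k) (by omega)
  have c1 := w.card_below t (k := k + 1) (by omega)
  have c2 := w.card_below t (k := k + 2) (by omega)
  have c3 := w.card_below (t + 1) (k := k + 1) (by omega)
  have a1 : w.Across i (w.below t k) (w.below t (k + 1)) := ⟨t, by rw [hi], by rw [hi]⟩
  have a2 : w.Across j (w.below t (k + 1)) (w.below t (k + 2)) := ⟨t, by rw [hj], by rw [hj]⟩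
  have a3 : w.Across i (w.below (t + 1) (k + 1)) (w.below t (k + 2)) :=
    ⟨t + 1, by rw [hi'], by rw [hi', e2]⟩
  have a4 : w.Across j (w.below t k) (w.below (t + 1) (k + 1)) :=
    ⟨t + 1, by rw [hj', e0], by rw [hj']⟩
  have p1 : P (w.below t (k + 1)) := hP _ (Near.refl _ _)
  have p0 : P (w.below t k) := hP _ (near_below _ _ (by omega) (by omega))
  have p2 : P (w.below t (k + 2)) := hP _ (near_below _ _ (by omega) (by omega))
  have p3 : P (w.below (t + 1) (k + 1)) := by
    apply hP
    have h1 : Near 1 (w.below t (k + 1)) (w.below t k) := near_below _ _ (by omega) (by omega)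
    have h2 : Near 1 (w.below (t + 1) k) (w.below (t + 1) (k + 1)) :=
      near_below _ _ (by omega) (by omega)
    rw [e0] at h2
    exact h1.trans h2
  have hpar : Even (k + 1) ↔ ¬ Even k := Nat.even_add_one
  have hpar2 : Even (k + 2) ↔ Even k := by simp [Nat.even_add]
  have hcol : χ j = true ↔ ¬ χ i = true := by
    revert hij; cases χ i <;> cases χ j <;> simp
  have sw : ∀ Z, Z = w.below t k ∨ Z = w.below t (k + 1) ∨ Z = w.below t (k + 2) ∨
      Z = w.below (t + 1) (k + 1) → Z = w.below t k ∨ Z = w.below (t + 1) (k + 1) ∨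
      Z = w.below t (k + 2) ∨ Z = w.below t (k + 1) := by
    rintro Z (h | h | h | h)
    exacts [.inl h, .inr (.inr (.inr h)), .inr (.inr (.inl h)), .inr (.inl h)]
  let R := fun X Y => P X ∧ P Y ∧ w.Step χ X Y
  by_cases h : (χ i = true ↔ Even k)
  · have s1 : R _ _ :=
      ⟨p0, p1, i, Or.inl a1, by rw [c0]; exact h⟩
    have s2 : R _ _ :=
      ⟨p1, p2, j, Or.inl a2, by rw [c1, hpar, hcol, h]⟩
    have s3 : R _ _ :=
      ⟨p2, p3, i, Or.inr a3, by rw [c2, hpar2]; exact h⟩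
    have s4 : R _ _ :=
      ⟨p3, p0, j, Or.inr a4, by rw [c3, hpar, hcol, h]⟩
    exact ⟨reflTransGen_of_fourCycle (R := R) s1 s2 s3 s4 hX hY,
      reflTransGen_of_fourCycle (R := R) s1 s2 s3 s4 hY hX⟩
  · have h' : χ i = true ↔ ¬ Even k := (not_iff_comm.1 (not_iff.1 h)).symm
    have s1 : R _ _ :=
      ⟨p0, p3, j, Or.inl a4, by rw [c0, hcol, h', not_not]⟩
    have s2 : R _ _ :=
      ⟨p3, p2, i, Or.inl a3, by rw [c3, hpar]; exact h'⟩
    have s3 : R _ _ :=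
      ⟨p2, p1, j, Or.inr a2, by rw [c2, hpar2, hcol, h', not_not]⟩
    have s4 : R _ _ :=
      ⟨p1, p0, i, Or.inr a1, by rw [c1, hpar]; exact h'⟩
    exact ⟨reflTransGen_of_fourCycle (R := R) s1 s2 s3 s4 (sw X hX) (sw Y hY),
      reflTransGen_of_fourCycle (R := R) s1 s2 s3 s4 (sw Y hY) (sw X hX)⟩

end Wiring

/-! ### Linked faces in a column -/

namespace Wiring

variable {n : ℕ} {w : Wiring n} {χ : Fin n → Bool} {P : Finset (Fin n) → Prop}

/-- Gap `k` of column `t` divides the lines of color `b` into those in `β`, which are below it,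
and the others, which are above it. -/
def Splits (w : Wiring n) (χ : Fin n → Bool) (b : Bool) (β : Finset (Fin n)) (t k : ℕ) : Prop :=
  ∀ i, χ i = b → (i ∈ β ↔ w.pos t i < k)

/-- Gap `k` of column `t` is the one just above the topmost line of color `b` in `β`. -/
def IsLow (w : Wiring n) (χ : Fin n → Bool) (b : Bool) (β : Finset (Fin n)) (t k : ℕ) : Prop :=
  w.Splits χ b β t k ∧ ∃ i, χ i = b ∧ w.pos t i + 1 = k

/-- Gap `k` of column `t` is the one just below the lowest line of color `b` outside `β`. -/
def IsUp (w : Wiring n) (χ : Fin n → Bool) (b : Bool) (β : Finset (Fin n)) (t k : ℕ) : Prop :=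
  w.Splits χ b β t k ∧ ∃ i, χ i = b ∧ w.pos t i = k

/-- In column `t`, the lines of color `b` in `β` are below the other lines of color `b`. -/
def Separated (w : Wiring n) (χ : Fin n → Bool) (b : Bool) (β : Finset (Fin n)) (t : ℕ) : Prop :=
  ∀ i j, χ i = b → χ j = b → i ∈ β → j ∉ β → w.pos t i < w.pos t j

variable {b : Bool} {β : Finset (Fin n)}

theorem Splits.separated {t k : ℕ} (h : w.Splits χ b β t k) : w.Separated χ b β t := by
  intro i j hi hj hiβ hjβ
  have h1 := (h i hi).1 hiβ
  have h2 := (h j hj).not.1 hjβ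
  omega

theorem Separated.exists_isLow {t : ℕ} (h : w.Separated χ b β t) {i : Fin n} (hi : χ i = b)
    (hiβ : i ∈ β) : ∃ k, w.IsLow χ b β t k := by
  obtain ⟨a, ha, hmax⟩ := (β.filter (χ · = b)).exists_max_image (w.pos t)
    ⟨i, Finset.mem_filter.2 ⟨hiβ, hi⟩⟩
  rw [Finset.mem_filter] at ha
  refine ⟨w.pos t a + 1, fun j hj => ⟨fun hjβ => ?_, fun hlt => ?_⟩, a, ha.2, rfl⟩
  · have := hmax j (Finset.mem_filter.2 ⟨hjβ, hj⟩)
    omega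
  · by_contra hjβ
    have := h a j ha.2 hj ha.1 hjβ
    omega

theorem Separated.exists_isUp {t : ℕ} (h : w.Separated χ b β t) {i : Fin n} (hi : χ i = b)
    (hiβ : i ∉ β) : ∃ k, w.IsUp χ b β t k := by
  obtain ⟨a, ha, hmin⟩ := (Finset.univ.filter fun i => i ∉ β ∧ χ i = b).exists_min_image (w.pos t)
    ⟨i, by simp [hiβ, hi]⟩
  rw [Finset.mem_filter] at ha
  refine ⟨w.pos t a, fun j hj => ⟨fun hjβ => h j a hj ha.2.2 hjβ ha.2.1, fun hlt => ?_⟩,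
    a, ha.2.2, rfl⟩
  by_contra hjβ
  have := hmin j (by simp [hjβ, hj])
  omega

theorem IsLow.unique {t k k' : ℕ} (h : w.IsLow χ b β t k) (h' : w.IsLow χ b β t k') : k = k' := by
  obtain ⟨hs, i, hi, rfl⟩ := h
  obtain ⟨hs', i', hi', rfl⟩ := h'
  have h1 := (hs' i hi).1 ((hs i hi).2 (by omega))
  have h2 := (hs i' hi').1 ((hs' i' hi').2 (by omega))
  omega

theorem IsUp.unique {t k k' : ℕ} (h : w.IsUp χ b β t k) (h' : w.IsUp χ b β t k') : k = k' := by
  obtain ⟨hs, i, hi, rfl⟩ := h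
  obtain ⟨hs', i', hi', rfl⟩ := h'
  have h1 := (hs i hi).not.2 (by omega)
  have h2 := (hs' i' hi').not.2 (by omega)
  have h3 := (hs' i hi).not.1 h1
  have h4 := (hs i' hi').not.1 h2
  omega

/-- The faces just above the topmost line of color `b` in `β` are linked in consecutive columns:
where they differ, that line crosses a line of the other color, since it stays the topmost. -/
theorem IsLow.linked_succ {s k k' : ℕ} (h : w.IsLow χ b β s k) (h' : w.IsLow χ b β (s + 1) k')
    (hP : ∀ X, Near 3 (w.below s k) X → P X) :
    w.Linked χ P (w.below s k) (w.below (s + 1) k') := by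
  obtain ⟨hs, i, hi, hik⟩ := h
  obtain ⟨hs', i', hi', hik'⟩ := h'
  have hiβ := (hs i hi).2 (by omega)
  have h1 := (hs' i hi).1 hiβ
  have h2 := (hs i' hi').1 ((hs' i' hi').2 (by omega))
  have d1 := w.step_le s i
  have d2 := w.step_le s i'
  rcases lt_trichotomy k k' with hlt | rfl | hlt
  · have : i' = i := w.inj s (by omega)
    subst this
    obtain ⟨j, hj, hj'⟩ := swap_of_up (w := w) (t := s) (k := k) (i := i') (by omega) (by omega)
    have hjb : χ j ≠ b := fun hjb => by
      have := (hs j hjb).1 ((hs' j hjb).2 (by omega))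
      omega
    obtain ⟨l, rfl⟩ : ∃ l, k = l + 1 := ⟨k - 1, by omega⟩
    refine linked_of_crossing (k := l) (i := i') (j := j) (t := s) (by omega) (by omega) (by omega)
      (by omega) (by rw [hi']; exact hjb.symm) (fun X hX => hP X (hX.mono (by omega)))
      (Or.inr (Or.inl rfl)) ?_
    obtain rfl : k' = l + 2 := by omega
    right; right; left
    apply below_succ_eq
    intro a ha ha'
    have : a = j := w.inj s (by omega)
    subst this; omega
  · rw [below_succ_eq]
    · exact Linked.refl _
    · intro a ha ha'
      have : a = i := w.inj s (by omega)
      subst this; omega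
  · obtain ⟨j, hj, hj'⟩ := swap_of_down (w := w) (t := s) (k := k') (j := i) (by omega) (by omega)
    have hjb : χ j ≠ b := fun hjb => by
      have := (hs' j hjb).1 ((hs j hjb).2 (by omega))
      omega
    obtain ⟨l, rfl⟩ : ∃ l, k' = l + 1 := ⟨k' - 1, by omega⟩
    obtain rfl : k = l + 2 := by omega
    refine linked_of_crossing (k := l) (i := j) (j := i) (t := s) (by omega) (by omega) (by omega)
      (by omega) (by rw [hi]; exact hjb)
      (fun X hX => hP X (((near_below s _ (by omega) (by omega)).trans hX).mono (r := 1 + 2)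
        (by omega)))
      (Or.inr (Or.inr (Or.inl rfl))) (Or.inr (Or.inr (Or.inr rfl)))

/-- The counterpart of `IsLow.linked_succ` below the lowest line of color `b` outside `β`. -/
theorem IsUp.linked_succ {s k k' : ℕ} (h : w.IsUp χ b β s k) (h' : w.IsUp χ b β (s + 1) k')
    (hP : ∀ X, Near 3 (w.below s k) X → P X) :
    w.Linked χ P (w.below s k) (w.below (s + 1) k') := by
  obtain ⟨hs, i, hi, hik⟩ := h
  obtain ⟨hs', i', hi', hik'⟩ := h'
  have hiβ := (hs i hi).not.2 (by omega)
  have h1 := (hs' i hi).not.1 hiβ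
  have h2 := (hs i' hi').not.1 ((hs' i' hi').not.2 (by omega))
  have d1 := w.step_le s i
  have d2 := w.step_le s i'
  rcases lt_trichotomy k k' with hlt | rfl | hlt
  · obtain ⟨j, hj, hj'⟩ := swap_of_up (w := w) (t := s) (k := k') (i := i) (by omega) (by omega)
    have hjb : χ j ≠ b := fun hjb => by
      have := (hs j hjb).1 ((hs' j hjb).2 (by omega))
      omega
    obtain rfl : k' = k + 1 := by omega
    refine linked_of_crossing (k := k) (i := i) (j := j) (t := s) (by omega) (by omega) (by omega)
      (by omega) (by rw [hi]; exact hjb.symm)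
      (fun X hX => hP X (((near_below s _ (by omega) (by omega)).trans hX).mono (r := 1 + 2)
        (by omega)))
      (Or.inl rfl) (Or.inr (Or.inr (Or.inr rfl)))
  · rw [below_succ_eq]
    · exact Linked.refl _
    · intro a ha ha'
      obtain ⟨j, hj, hj'⟩ := swap_of_up (w := w) (t := s) (k := k) (i := a) (by omega) (by omega)
      have : j = i := w.inj s (by omega)
      subst this; omega
  · have : i' = i := w.inj s (by omega)
    subst this
    obtain ⟨j, hj, hj'⟩ := swap_of_down (w := w) (t := s) (k := k) (j := i') (by omega) (by omega)
    have hjb : χ j ≠ b := fun hjb => by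
      have := (hs' j hjb).1 ((hs j hjb).2 (by omega))
      omega
    obtain rfl : k = k' + 1 := by omega
    refine linked_of_crossing (k := k') (i := j) (j := i') (t := s) (by omega) (by omega)
      (by omega) (by omega) (by rw [hi']; exact hjb) (fun X hX => hP X (hX.mono (by omega)))
      (Or.inr (Or.inl rfl)) ?_
    left
    apply below_succ_eq
    intro a ha ha'
    have : a = i' := w.inj (s + 1) (by omega)
    subst this; omega

/-- If `β` is separated from the other lines of color `b` in one of two consecutive columns `s` and
`s'` but not in the other, then in the first one no line runs between the two groups. -/
theorem Separated.low_eq_up {s s' k k' : ℕ}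
    (hss : ∀ i, w.pos s' i ≤ w.pos s i + 1 ∧ w.pos s i ≤ w.pos s' i + 1)
    (hsep : w.Separated χ b β s) (hnot : ¬ w.Separated χ b β s')
    (hk : w.IsLow χ b β s k) (hk' : w.IsUp χ b β s k') : k = k' := by
  simp only [Separated, not_forall, not_lt] at hnot
  obtain ⟨i, j, hi, hj, hiβ, hjβ, hle⟩ := hnot
  have h1 := hsep i j hi hj hiβ hjβ
  have d1 := hss i
  have d2 := hss j
  have hne : w.pos s' j ≠ w.pos s' i := fun h => hjβ (w.inj _ h ▸ hiβ)
  obtain ⟨hs, a, ha, hak⟩ := hk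
  obtain ⟨hs', a', ha', hak'⟩ := hk'
  have h2 := (hs i hi).1 hiβ
  have h3 := (hs' j hj).not.1 hjβ
  have h4 := (hs j hj).not.1 hjβ
  have h5 := (hs' i hi).1 hiβ
  have h6 := hsep a j ha hj ((hs a ha).2 (by omega)) hjβ
  have h7 := hsep i a' hi ha' hiβ ((hs' a' ha').not.2 (by omega))
  omega

/-- No two faces are separated in one direction by `m` or more lines of only one color. -/
def Mixed (w : Wiring n) (χ : Fin n → Bool) (m : ℕ) : Prop :=
  ∀ t k t' k' b, (∀ i ∈ w.below t k \ w.below t' k', χ i = b) →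
    (w.below t k \ w.below t' k').card < m

/-- Gaps that split the lines of color `b` in the same way are separated by lines of the other color
only. -/
theorem Splits.near {m : ℕ} (hm : w.Mixed χ m) {t k t' k' : ℕ} (h : w.Splits χ b β t k)
    (h' : w.Splits χ b β t' k') : Near m (w.below t k) (w.below t' k') := by
  constructor
  · refine (hm _ _ _ _ (!b) fun i hi => ?_).le
    simp only [Finset.mem_sdiff, mem_below] at hi
    by_contra hib
    have hib : χ i = b := by revert hib; cases χ i <;> cases b <;> simp
    exact hi.2 ((h i hib).1 ((h' i hib).2 hi.1))
  · refine (hm _ _ _ _ (!b) fun i hi => ?_).le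
    simp only [Finset.mem_sdiff, mem_below] at hi
    by_contra hib
    have hib : χ i = b := by revert hib; cases χ i <;> cases b <;> simp
    exact hi.2 ((h' i hib).1 ((h i hib).2 hi.1))

/-- As long as `β` stays separated from the other lines of color `b`, the faces along either group
are linked. No line of color `b` separates them from the face at `(t₀, k₀)`, so they are near it. -/
theorem linked_of_separated {m : ℕ} (hm : w.Mixed χ m) {t₀ k₀ : ℕ} (h₀ : w.Splits χ b β t₀ k₀)
    (hP : ∀ X, Near (m + 3) (w.below t₀ k₀) X → P X) {a c : Fin n} (ha : χ a = b) (haβ : a ∈ β)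
    (hc : χ c = b) (hcβ : c ∉ β) {s s' : ℕ} (hss : s ≤ s')
    (hsep : ∀ r, s ≤ r → r ≤ s' → w.Separated χ b β r) :
    (∀ k k', w.IsLow χ b β s k → w.IsLow χ b β s' k' →
      w.Linked χ P (w.below s k) (w.below s' k')) ∧
    (∀ k k', w.IsUp χ b β s k → w.IsUp χ b β s' k' →
      w.Linked χ P (w.below s k) (w.below s' k')) := by
  induction s', hss using Nat.le_induction with
  | base =>
    exact ⟨fun k k' h h' => by rw [h.unique h']; exact Linked.refl _,
      fun k k' h h' => by rw [h.unique h']; exact Linked.refl _⟩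
  | succ s' hss ih =>
    obtain ⟨ih1, ih2⟩ := ih fun r h1 h2 => hsep r h1 (by omega)
    constructor
    · intro k k' h h'
      obtain ⟨l, hl⟩ := (hsep s' hss (by omega)).exists_isLow ha haβ
      exact (ih1 k l h hl).trans (hl.linked_succ h' fun X hX => hP X ((h₀.near hm hl.1).trans hX))
    · intro k k' h h'
      obtain ⟨l, hl⟩ := (hsep s' hss (by omega)).exists_isUp hc hcβ
      exact (ih2 k l h hl).trans (hl.linked_succ h' fun X hX => hP X ((h₀.near hm hl.1).trans hX))

/-- Two gaps of one column, with lines of color `b` below the lower and above the upper one and only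
lines of the other color between them, lead to linked faces: the region between the
two groups of `b`-colored lines has to end at a crossing of two of them, on the left or on the
right, because the vertical order of the lines in the first column is reversed in the last. -/
theorem linked_of_run {m : ℕ} (hm : w.Mixed χ m) {t g g' : ℕ} (hgg : g ≤ g')
    {a c : Fin n} (ha : χ a = b) (hag : w.pos t a + 1 = g) (hc : χ c = b) (hcg : w.pos t c = g')
    (hrun : ∀ i, g ≤ w.pos t i → w.pos t i < g' → χ i ≠ b)
    (hP : ∀ X, Near (m + 3) (w.below t g) X → P X) :
    w.Linked χ P (w.below t g) (w.below t g') := by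
  have hlow : w.IsLow χ b (w.below t g) t g := ⟨fun i _ => mem_below, a, ha, hag⟩
  have hup : w.IsUp χ b (w.below t g) t g' := by
    refine ⟨fun i hi => ?_, c, hc, hcg⟩
    rw [mem_below]
    have := hrun i
    by_contra hcon
    exact hrun i (by omega) (by omega) hi
  have haβ : a ∈ w.below t g := by rw [mem_below]; omega
  have hcβ : c ∉ w.below t g := by rw [mem_below]; omega
  have hsep := hlow.1.separated
  have link := fun s s' hss hsep' => linked_of_separated (P := P) hm hlow.1 hP ha haβ hc hcβ
    (s := s) (s' := s') hss hsep'
  by_cases hR : ∃ s, t ≤ s ∧ ¬ w.Separated χ b (w.below t g) s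
  · classical
    obtain ⟨hts, hs⟩ := Nat.find_spec hR
    have hmin : ∀ r, t ≤ r → r < Nat.find hR → w.Separated χ b (w.below t g) r := fun r h1 h2 => by
      have := Nat.find_min hR h2
      by_contra h3
      exact this ⟨h1, h3⟩
    have hne : t ≠ Nat.find hR := fun h => hs (h ▸ hsep)
    obtain ⟨s, hs1⟩ : ∃ s, Nat.find hR = s + 1 := ⟨Nat.find hR - 1, by omega⟩
    rw [hs1] at hmin hs hts hne
    have hss := hmin s (by omega) (by omega)
    obtain ⟨k, hk⟩ := hss.exists_isLow ha haβ
    obtain ⟨k', hk'⟩ := hss.exists_isUp hc hcβ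
    have := hss.low_eq_up (w.step_le s) hs hk hk'
    subst this
    obtain ⟨l1, l2⟩ := link t s (by omega) fun r h1 h2 => hmin r h1 (by omega)
    exact (l1 _ _ hlow hk).trans (l2 _ _ hup hk').symm
  · push Not at hR
    have hT : w.Separated χ b (w.below t g) w.T := by
      have := hR (max t w.T) (le_max_left _ _)
      rwa [Separated, w.stable _ (le_max_right _ _)] at this
    have h0 : ¬ w.Separated χ b (w.below t g) 0 := fun h => by
      have h1 := h a c ha hc haβ hcβ
      have h2 := hT a c ha hc haβ hcβ
      have h3 := w.rev a c h1
      omega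
    classical
    set q := fun d => ¬ w.Separated χ b (w.below t g) (t - d) with hq
    have hL : ∃ d, q d := ⟨t, by simpa [hq] using h0⟩
    have hs := Nat.find_spec hL
    have hmin : ∀ r, r ≤ t → t < r + Nat.find hL → w.Separated χ b (w.below t g) r :=
      fun r h1 h2 => by
      have := Nat.find_min hL (m := t - r) (by omega)
      simp only [hq, not_not] at this
      rwa [show t - (t - r) = r by omega] at this
    have hle : Nat.find hL ≤ t := Nat.find_min' hL (by simpa [hq] using h0)
    have hne : Nat.find hL ≠ 0 := fun h => by
      rw [h] at hs
      exact hs hsep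
    obtain ⟨s, hs1⟩ : ∃ s, t = s + Nat.find hL := ⟨t - Nat.find hL, by omega⟩
    have hs : ¬ w.Separated χ b (w.below t g) s := by
      have : q (Nat.find hL) := hs
      simp only [hq] at this
      rwa [show t - Nat.find hL = s by omega] at this
    have hss := hmin (s + 1) (by omega) (by omega)
    obtain ⟨k, hk⟩ := hss.exists_isLow ha haβ
    obtain ⟨k', hk'⟩ := hss.exists_isUp hc hcβ
    have := hss.low_eq_up (fun i => (w.step_le s i).symm) hs hk hk'
    subst this
    obtain ⟨l1, l2⟩ := link (s + 1) t (by omega) fun r h1 h2 => hmin r h2 (by omega)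
    exact (l1 _ _ hk hlow).symm.trans (l2 _ _ hk' hup)

/-- The lines just below and just above gap `g` of column `t` have different colors. -/
def IsBi (w : Wiring n) (χ : Fin n → Bool) (t g : ℕ) : Prop :=
  ∃ i j, w.pos t i + 1 = g ∧ w.pos t j = g ∧ χ i ≠ χ j

/-- All bichromatic gaps of a column lead to linked faces. -/
theorem IsBi.linked {m : ℕ} (hm : w.Mixed χ m) {t g g' : ℕ} (hgg : g ≤ g')
    (h : w.IsBi χ t g) (h' : w.IsBi χ t g')
    (hP : ∀ l, g ≤ l → l ≤ g' → ∀ X, Near (m + 3) (w.below t l) X → P X) :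
    w.Linked χ P (w.below t g) (w.below t g') := by
  induction hd : g' - g using Nat.strong_induction_on generalizing g g' with
  | _ d ih =>
    rcases hgg.eq_or_lt with rfl | hlt
    · exact Linked.refl _
    by_cases hmid : ∃ l, g < l ∧ l < g' ∧ w.IsBi χ t l
    · obtain ⟨l, h1, h2, hl⟩ := hmid
      exact (ih (l - g) (by omega) h1.le h hl (fun r hr hr' => hP r hr (by omega)) rfl).trans
        (ih (g' - l) (by omega) h2.le hl h' (fun r hr hr' => hP r (by omega) hr') rfl)
    · push Not at hmid
      obtain ⟨i, j, hi, hj, hij⟩ := h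
      obtain ⟨i', j', hi', hj', hij'⟩ := h'
      -- between consecutive bichromatic gaps all lines have the color of `j`
      have hrun : ∀ l, g ≤ l → l < g' → ∀ a, w.pos t a = l → χ a = χ j := by
        intro l hl
        induction l, hl using Nat.le_induction with
        | base => intro _ a ha; rw [w.inj t (ha.trans hj.symm)]
        | succ l hl ihl =>
          intro hlt' a ha
          obtain ⟨e, he⟩ := w.exists_pos_eq t (k := l) (by have := w.pos_lt t a; omega)
          have h1 := ihl (by omega) e he
          have h2 := hmid (l + 1) (by omega) hlt'
          by_contra hne
          exact h2 ⟨e, a, by omega, ha, fun h3 => hne (h3.symm.trans h1)⟩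
      have hi'j : χ i' = χ j := hrun (w.pos t i') (by omega) (by omega) i' rfl
      refine linked_of_run (b := χ i) hm hgg rfl hi (c := j') ?_ hj' ?_
        (hP g le_rfl hgg)
      · rw [hi'j] at hij'
        revert hij hij'; cases χ i <;> cases χ j <;> cases χ j' <;> simp
      · intro a h1 h2 h3
        exact hij (h3.symm.trans (hrun _ h1 h2 a rfl))

/-- A bichromatic gap is linked to a neighbouring bichromatic gap of the next column. -/
theorem IsBi.exists_succ {t g : ℕ} (h : w.IsBi χ t g)
    (hP : ∀ X, Near 3 (w.below t g) X → P X) :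
    ∃ g', g' ≤ g + 1 ∧ g ≤ g' + 1 ∧ w.IsBi χ (t + 1) g' ∧
      w.Linked χ P (w.below t g) (w.below (t + 1) g') := by
  obtain ⟨i, j, hi, hj, hij⟩ := h
  have di := w.step_le t i
  have dj := w.step_le t j
  obtain ⟨l, rfl⟩ : ∃ l, g = l + 1 := ⟨g - 1, by omega⟩
  by_cases hsw : w.pos (t + 1) i = l + 1
  · -- `i` and `j` cross
    obtain ⟨j', h1, h2⟩ := swap_of_up (w := w) (t := t) (k := l + 1) (i := i) (by omega) (by omega)
    obtain rfl : j' = j := w.inj t (by omega)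
    exact ⟨l + 1, by omega, by omega, ⟨j', i, h2, hsw, hij.symm⟩,
      linked_of_crossing (by omega) hsw hj (by omega) hij
        (fun X hX => hP X (hX.mono (by omega))) (Or.inr (Or.inl rfl)) (Or.inr (Or.inr (Or.inr rfl)))⟩
  have hj0 : w.pos (t + 1) j ≠ l := fun hjl => by
    obtain ⟨i', h1, h2⟩ := swap_of_down (w := w) (t := t) (k := l + 1) (j := j)
      (by omega) (by omega)
    obtain rfl : i' = i := w.inj t (by omega)
    exact hsw h2
  have e0 : w.below (t + 1) (l + 1) = w.below t (l + 1) := by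
    apply below_succ_eq
    intro a ha ha'
    obtain rfl : a = i := w.inj t (by omega)
    exact hsw ha'
  by_cases hi0 : w.pos (t + 1) i = l
  · by_cases hj1 : w.pos (t + 1) j = l + 1
    · exact ⟨l + 1, by omega, by omega, ⟨i, j, by omega, hj1, hij⟩, by
        rw [e0]; exact Linked.refl _⟩
    · obtain ⟨c, h1, h2⟩ := swap_of_up (w := w) (t := t) (k := l + 2) (i := j)
        (by omega) (by omega)
      by_cases hic : χ i = χ c
      · refine ⟨l + 2, by omega, by omega, ⟨c, j, by omega, by omega, fun h => hij (hic.trans h)⟩,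
          linked_of_crossing (k := l + 1) (i := j) (j := c) hj (by omega) h1 (by omega)
            (fun h => hij (hic.trans h.symm)) (fun X hX => hP X (((near_below t _ (by omega)
              (by omega)).trans hX).mono (r := 1 + 2) (by omega)))
            (Or.inl rfl) (Or.inr (Or.inr (Or.inr rfl)))⟩
      · exact ⟨l + 1, by omega, by omega, ⟨i, c, by omega, by omega, hic⟩, by
          rw [e0]; exact Linked.refl _⟩
  · obtain ⟨c, h1, h2⟩ := swap_of_down (w := w) (t := t) (k := l) (j := i)
        (by omega) (by omega)
    by_cases hcj : χ c = χ j
    · obtain ⟨r, rfl⟩ : ∃ r, l = r + 1 := ⟨l - 1, by omega⟩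
      refine ⟨r + 1, by omega, by omega, ⟨i, c, by omega, by omega, fun h => hij (h.trans hcj)⟩,
          linked_of_crossing (k := r) (i := c) (j := i) (by omega) (by omega) (by omega) (by omega)
            (fun h => hij (h.symm.trans hcj)) (fun X hX => hP X (((near_below t _ (by omega)
              (by omega)).trans hX).mono (r := 1 + 2) (by omega)))
            (Or.inr (Or.inr (Or.inl rfl))) (Or.inr (Or.inr (Or.inr rfl)))⟩
    · by_cases hj1 : w.pos (t + 1) j = l + 1
      · exact ⟨l + 1, by omega, by omega, ⟨c, j, by omega, by omega, hcj⟩, by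
          rw [e0]; exact Linked.refl _⟩
      · -- both `i` and `j` leave the gap
        obtain ⟨c', h1', h2'⟩ := swap_of_up (w := w) (t := t) (k := l + 2) (i := j)
          (by omega) (by omega)
        by_cases hcc : χ c = χ c'
        · refine ⟨l + 2, by omega, by omega, ⟨c', j, by omega, by omega,
            fun h => hcj (hcc.trans h)⟩,
            linked_of_crossing (k := l + 1) (i := j) (j := c') hj (by omega) h1' (by omega)
            (fun h => hcj (hcc.trans h.symm)) (fun X hX => hP X (((near_below t _ (by omega)
              (by omega)).trans hX).mono (r := 1 + 2) (by omega)))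
            (Or.inl rfl) (Or.inr (Or.inr (Or.inr rfl)))⟩
        · exact ⟨l + 1, by omega, by omega, ⟨c, c', by omega, by omega, hcc⟩, by
            rw [e0]; exact Linked.refl _⟩

/-- Among `m` consecutive lines of a column two neighbours have different colors. -/
theorem Mixed.exists_isBi {m : ℕ} (hm : w.Mixed χ m) (hm0 : 0 < m) (t : ℕ) {k : ℕ}
    (hk : k + m ≤ n) : ∃ g, k < g ∧ g < k + m ∧ w.IsBi χ t g := by
  by_contra hcon
  push Not at hcon
  obtain ⟨a, ha⟩ := w.exists_pos_eq t (k := k) (by omega)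
  have hrun : ∀ l, k ≤ l → l < k + m → ∀ c, w.pos t c = l → χ c = χ a := by
    intro l hl
    induction l, hl using Nat.le_induction with
    | base => intro _ c hc; rw [w.inj t (hc.trans ha.symm)]
    | succ l hl ihl =>
      intro hlt' c hc
      obtain ⟨e, he⟩ := w.exists_pos_eq t (k := l) (by omega)
      have h1 := ihl (by omega) e he
      have h2 := hcon (l + 1) (by omega) hlt'
      by_contra hne
      exact h2 ⟨e, c, by omega, hc, fun h3 => hne (h3.symm.trans h1)⟩
  have h := hm t (k + m) t k (χ a) fun i hi => by
    simp only [Finset.mem_sdiff, mem_below] at hi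
    exact hrun _ (by omega) (by omega) i rfl
  have hsub : w.below t k ⊆ w.below t (k + m) := fun i hi => by
    rw [mem_below] at *; omega
  rw [Finset.card_sdiff_of_subset hsub, card_below t hk, card_below t (by omega)] at h
  omega

end Wiring

/-! ### Long paths along a snake -/

/-- Loop erasure: a directed walk contains a directed path with the same ends. -/
theorem Relation.ReflTransGen.exists_path {α : Type*} {R : α → α → Prop} {a b : α}
    (h : Relation.ReflTransGen R a b) :
    ∃ (k : ℕ) (F : ℕ → α), Set.InjOn F (Set.Iic k) ∧ F 0 = a ∧ F k = b ∧
      ∀ j < k, R (F j) (F (j + 1)) := by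
  induction h using Relation.ReflTransGen.head_induction_on with
  | refl => exact ⟨0, fun _ => b, by simp [Set.InjOn], rfl, rfl, by simp⟩
  | @head a c hac _ ih =>
    obtain ⟨k, F, hinj, h0, hk, hR⟩ := ih
    by_cases ha : ∃ m ≤ k, F m = a
    · obtain ⟨m, hmk, hm⟩ := ha
      refine ⟨k - m, fun j => F (m + j), ?_, by simpa using hm, ?_, ?_⟩
      · intro x hx y hy hxy
        simp only [Set.mem_Iic] at hx hy
        have := hinj (by simp only [Set.mem_Iic]; omega) (by simp only [Set.mem_Iic]; omega) hxy
        omega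
      · simpa [Nat.add_sub_cancel' hmk] using hk
      · intro j hj
        exact hR (m + j) (by omega)
    · push Not at ha
      refine ⟨k + 1, fun j => if j = 0 then a else F (j - 1), ?_, by simp, by simpa using hk, ?_⟩
      · intro x hx y hy hxy
        simp only [Set.mem_Iic] at hx hy
        rcases Nat.eq_zero_or_pos x with rfl | hx0 <;> rcases Nat.eq_zero_or_pos y with rfl | hy0
        · rfl
        · simp only [if_pos, if_neg hy0.ne'] at hxy
          exact absurd hxy.symm (ha _ (by omega))
        · simp only [if_pos, if_neg hx0.ne'] at hxy
          exact absurd hxy (ha _ (by omega))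
        · simp only [if_neg hx0.ne', if_neg hy0.ne'] at hxy
          have := hinj (by simp only [Set.mem_Iic]; omega) (by simp only [Set.mem_Iic]; omega) hxy
          omega
      · intro j hj
        rcases Nat.eq_zero_or_pos j with rfl | hj0
        · simpa [h0] using hac
        · obtain ⟨j, rfl⟩ : ∃ l, j = l + 1 := ⟨j - 1, by omega⟩
          simpa using hR j (by omega)

theorem Near.card_inter_le {α : Type*} [DecidableEq α] {r : ℕ} {X Y : Finset α} (h : Near r X Y)
    (Z : Finset α) :
    (X ∩ Z).card ≤ (Y ∩ Z).card + r := by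
  refine (Finset.card_le_card (t := (Y ∩ Z) ∪ (X \ Y)) ?_).trans
    ((Finset.card_union_le _ _).trans (by have := h.2; omega))
  intro a
  simp only [Finset.mem_inter, Finset.mem_union, Finset.mem_sdiff]
  tauto

/-- The distance travelled along a snake through horizontal strips of height `v`, that runs through
strip `i` from progress `p = 0` to progress `p = K` if `i` is even and back if `i` is odd. -/
def snake (v K u p : ℕ) : ℕ := u / v * K + if Even (u / v) then p else K - p

/-- The snake fills the lower half of each strip. In the upper half it only passes at that end of
the strip at which it turns. -/
def InSnake (v K u p : ℕ) : Prop :=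
  u % v < v / 2 ∨ (if Even (u / v) then p = K else p = 0)

theorem snake_succ {v K u p p' : ℕ} (hv : 2 ≤ v) (hp : p ≤ K) (hp' : p' ≤ K) (h1 : p ≤ p' + 1)
    (h2 : p' ≤ p + 1) (hin : InSnake v K u p) :
    snake v K (u + 1) p' ≤ snake v K u p + 1 ∧ snake v K u p ≤ snake v K (u + 1) p' + 1 := by
  unfold snake InSnake at *
  rw [Nat.succ_div]
  by_cases hd : v ∣ u + 1
  · have hmod : ¬ u % v < v / 2 := by
      obtain ⟨c, hc⟩ := hd
      obtain ⟨c, rfl⟩ : ∃ e, c = e + 1 := ⟨c - 1, by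
        rcases c with _ | c
        · simp at hc
        · simp⟩
      have hu : u = (v - 1) + v * c := by rw [mul_add] at hc; omega
      rw [hu, Nat.add_mul_mod_self_left, Nat.mod_eq_of_lt (by omega)]
      omega
    have hin := hin.resolve_left hmod
    simp only [if_pos hd, Nat.even_add_one, add_mul, one_mul]
    generalize u / v = q at *
    by_cases hq : Even q
    · simp only [hq, if_true, not_true, if_false] at *
      omega
    · simp only [hq, if_true, not_false_iff, if_false] at *
      omega
  · rw [if_neg hd, add_zero]
    generalize u / v = q at *
    split_ifs <;> omega

namespace Wiring

variable {n : ℕ} {w : Wiring n} {χ : Fin n → Bool}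

/-- The lines that form the upper half of the first column. -/
def upperHalf (w : Wiring n) : Finset (Fin n) := Finset.univ.filter fun i => n / 2 ≤ w.pos 0 i

/-- How far to the right a face is, up to a cutoff at both ends: the number of lines of the upper
half that are below the face, reduced by `s` and capped at `K`. -/
def progress (w : Wiring n) (s K : ℕ) (X : Finset (Fin n)) : ℕ := min K ((X ∩ w.upperHalf).card - s)

/-- The faces on a snake of strips of height `6 * s`, which starts at level `base`. -/
def Corridor (w : Wiring n) (s K base : ℕ) (X : Finset (Fin n)) : Prop :=
  base ≤ X.card ∧ InSnake (6 * s) K (X.card - base) (w.progress s K X)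

/-- Each step in the corridor advances by at most one on the snake. -/
theorem Step.snake_le {s K base : ℕ} (hs : 1 ≤ s) {X Y : Finset (Fin n)} (h : w.Step χ X Y)
    (hX : w.Corridor s K base X) (hY : w.Corridor s K base Y) :
    snake (6 * s) K (Y.card - base) (w.progress s K Y) ≤
      snake (6 * s) K (X.card - base) (w.progress s K X) + 1 := by
  have key : ∀ {X Y : Finset (Fin n)} {i : Fin n}, i ∉ X → Y = Insert.insert i X →
      w.progress s K X ≤ w.progress s K Y + 1 ∧ w.progress s K Y ≤ w.progress s K X + 1 := by
    rintro X Y i hi rfl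
    have h1 : (X ∩ w.upperHalf).card ≤ (Insert.insert i X ∩ w.upperHalf).card :=
      Finset.card_le_card (Finset.inter_subset_inter_right (Finset.subset_insert _ _))
    have h2 : (Insert.insert i X ∩ w.upperHalf).card ≤ (X ∩ w.upperHalf).card + 1 := by
      refine (Finset.card_le_card (t := Insert.insert i (X ∩ w.upperHalf)) ?_).trans
        (Finset.card_insert_le _ _)
      intro a
      simp only [Finset.mem_inter, Finset.mem_insert]
      tauto
    unfold progress
    omega
  have hcap : ∀ X, w.progress s K X ≤ K := fun X => min_le_left _ _
  obtain ⟨i, ⟨hi, hY'⟩ | ⟨hi, hX'⟩⟩ := h.insert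
  · obtain ⟨k1, k2⟩ := key hi hY'
    have hc : Y.card - base = X.card - base + 1 := by
      have := hX.1
      rw [hY', Finset.card_insert_of_notMem hi]; omega
    rw [hc]
    exact (snake_succ (by omega) (hcap X) (hcap Y) k1 k2 hX.2).1
  · obtain ⟨k1, k2⟩ := key hi hX'
    have hc : X.card - base = Y.card - base + 1 := by
      have := hY.1
      rw [hX', Finset.card_insert_of_notMem hi]; omega
    rw [hc]
    exact (snake_succ (by omega) (hcap Y) (hcap X) k1 k2 hY.2).2

theorem card_upperHalf : w.upperHalf.card = n - n / 2 := by
  have h1 : w.upperHalf = (w.below 0 (n / 2))ᶜ := by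
    ext i; simp [upperHalf]
  rw [h1, Finset.card_compl, card_below 0 (Nat.div_le_self _ _), Fintype.card_fin]

/-- In the first column, the lower half of the levels contains no line of the upper half. -/
theorem below_zero_inter_upperHalf {l : ℕ} (hl : l ≤ n / 2) :
    (w.below 0 l ∩ w.upperHalf).card = 0 := by
  rw [Finset.card_eq_zero, Finset.eq_empty_iff_forall_notMem]
  intro i
  simp only [Finset.mem_inter, mem_below, upperHalf, Finset.mem_filter, Finset.mem_univ, true_and]
  omega

/-- In the last column, the lower half of the levels consists of lines of the upper half. -/
theorem below_T_inter_upperHalf {l : ℕ} (hl : l ≤ n / 2) :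
    (w.below w.T l ∩ w.upperHalf).card = l := by
  have hsub : w.below w.T l ⊆ w.upperHalf := by
    intro i hi
    by_contra hiU
    have h1 : Insert.insert i w.upperHalf ⊆ w.below w.T l := by
      intro j hj
      rcases Finset.mem_insert.1 hj with rfl | hj
      · exact hi
      · simp only [upperHalf, Finset.mem_filter, Finset.mem_univ, true_and] at hj hiU
        rw [mem_below] at *
        have := w.rev i j (by omega)
        omega
    have h2 := Finset.card_le_card h1
    rw [Finset.card_insert_of_notMem hiU, card_upperHalf, card_below _ (by omega)] at h2
    omega
  rw [Finset.inter_eq_left.2 hsub, card_below _ (by omega)]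

theorem IsBi.linked_of_level {m : ℕ} (hm : w.Mixed χ m) {P : Finset (Fin n) → Prop} {t lo hi : ℕ}
    (hP : ∀ l, lo ≤ l → l ≤ hi → ∀ X, Near (m + 3) (w.below t l) X → P X) {g g' : ℕ}
    (h : w.IsBi χ t g) (h' : w.IsBi χ t g') (hg : lo ≤ g ∧ g ≤ hi) (hg' : lo ≤ g' ∧ g' ≤ hi) :
    w.Linked χ P (w.below t g) (w.below t g') := by
  rcases le_total g g' with hle | hle
  · exact h.linked hm hle h' fun l h1 h2 => hP l (by omega) (by omega)
  · exact (h'.linked hm hle h fun l h1 h2 => hP l (by omega) (by omega)).symm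

/-- If no large set of lines separating two faces is monochromatic, then there is an alternating
path along the snake. -/
theorem Mixed.exists_long_path {m : ℕ} (hm : w.Mixed χ m) (hm2 : 2 ≤ m) {s K base r : ℕ}
    (hs : s = m + 3) (hbase : K + 2 * s ≤ base) (hr : base + r * (6 * s) + 3 * s ≤ n / 2) :
    ∃ (k : ℕ) (F : ℕ → Finset (Fin n)), Set.InjOn F (Set.Iic k) ∧
      (∀ j < k, w.Step χ (F j) (F (j + 1))) ∧ (r - 1) * K ≤ k := by
  set P := w.Corridor s K base with hPdef
  have hstrip : ∀ i ≤ r, i * (6 * s) ≤ r * (6 * s) := fun i hi => Nat.mul_le_mul_right _ hi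
  -- faces near the middle of the lower half of a strip are in the corridor
  have hmid : ∀ i ≤ r, ∀ t l, base + i * (6 * s) + s ≤ l → l ≤ base + i * (6 * s) + 2 * s - 1 →
      ∀ X, Near (m + 3) (w.below t l) X → P X := by
    intro i hi t l h1 h2 X hX
    have := hstrip i hi
    have c1 := hX.card_inter_le Finset.univ
    have c2 := hX.symm.card_inter_le Finset.univ
    simp only [Finset.inter_univ] at c1 c2
    rw [card_below t (by omega)] at c1 c2
    refine ⟨by omega, Or.inl ?_⟩
    obtain ⟨e, he⟩ : ∃ e, X.card - base = e + 6 * s * i :=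
      ⟨X.card - base - 6 * s * i, by rw [mul_comm (6 * s) i]; omega⟩
    rw [mul_comm (6 * s) i] at he
    rw [he, mul_comm i, Nat.add_mul_mod_self_left, Nat.mod_eq_of_lt (by omega)]
    omega
  -- faces above this and near the turning end are in the corridor as well
  have hturn : ∀ i < r, ∀ t l, base + i * (6 * s) + s ≤ l →
      l ≤ base + (i + 1) * (6 * s) + 2 * s - 1 →
      (∀ X, Near (m + 3) (w.below t l) X → if Even i then w.progress s K X = K else
        w.progress s K X = 0) → ∀ X, Near (m + 3) (w.below t l) X → P X := by
    intro i hi t l h1 h2 hprog X hX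
    have := hstrip (i + 1) hi
    have c1 := hX.card_inter_le Finset.univ
    have c2 := hX.symm.card_inter_le Finset.univ
    simp only [Finset.inter_univ] at c1 c2
    rw [card_below t (by omega)] at c1 c2
    have hexp : (i + 1) * (6 * s) = i * (6 * s) + 6 * s := by ring
    by_cases hc : X.card - base < i * (6 * s) + 6 * s
    · refine ⟨by omega, Or.inr ?_⟩
      rw [Nat.div_eq_of_lt_le (k := i) (by omega) (by rw [hexp]; exact hc)]
      exact hprog X hX
    · refine ⟨by omega, Or.inl ?_⟩
      obtain ⟨e, he⟩ : ∃ e, X.card - base = e + (i + 1) * (6 * s) :=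
        ⟨X.card - base - (i + 1) * (6 * s), by omega⟩
      rw [he, mul_comm (i + 1), Nat.add_mul_mod_self_left, Nat.mod_eq_of_lt (by omega)]
      omega
  have hgap : ∀ i t, ∃ g, i ≤ r → base + i * (6 * s) + s < g ∧ g < base + i * (6 * s) + s + m ∧
      w.IsBi χ t g := by
    intro i t
    by_cases hi : i ≤ r
    · have := hstrip i hi
      obtain ⟨g, hg⟩ := hm.exists_isBi (by omega) t (k := base + i * (6 * s) + s) (by omega)
      exact ⟨g, fun _ => hg⟩
    · exact ⟨0, fun h => absurd h hi⟩
  choose γ hγ using hgap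
  -- along a strip
  have halong : ∀ i ≤ r, ∀ t, w.Linked χ P (w.below 0 (γ i 0)) (w.below t (γ i t)) := by
    intro i hi t
    induction t with
    | zero => exact Linked.refl _
    | succ t ih =>
      obtain ⟨h1, h2, h3⟩ := hγ i t hi
      obtain ⟨h1', h2', h3'⟩ := hγ i (t + 1) hi
      obtain ⟨g, hg1, hg2, hg, hl⟩ := h3.exists_succ (P := P) fun X hX =>
        hmid i hi t _ (by omega) (by omega) X (hX.mono (by omega))
      exact (ih.trans hl).trans (IsBi.linked_of_level hm (hmid i hi (t + 1)) hg h3'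
        ⟨by omega, by omega⟩ ⟨by omega, by omega⟩)
  -- from each strip to the next
  have hnext : ∀ i < r, w.Linked χ P (w.below 0 (γ i 0)) (w.below 0 (γ (i + 1) 0)) := by
    intro i hi
    have hexp : (i + 1) * (6 * s) = i * (6 * s) + 6 * s := by ring
    have hb := hstrip (i + 1) hi
    by_cases hev : Even i
    · refine ((halong i hi.le w.T).trans ?_).trans (halong (i + 1) hi w.T).symm
      obtain ⟨h1, h2, h3⟩ := hγ i w.T hi.le
      obtain ⟨h1', h2', h3'⟩ := hγ (i + 1) w.T hi
      refine IsBi.linked_of_level hm (lo := base + i * (6 * s) + s)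
        (hi := base + (i + 1) * (6 * s) + 2 * s - 1) (fun l h4 h5 => hturn i hi w.T l h4 h5 ?_)
        h3 h3' ⟨by omega, by omega⟩ ⟨by omega, by omega⟩
      intro X hX
      have c1 := hX.card_inter_le w.upperHalf
      rw [below_T_inter_upperHalf (by omega)] at c1
      rw [if_pos hev]
      unfold progress
      omega
    · obtain ⟨h1, h2, h3⟩ := hγ i 0 hi.le
      obtain ⟨h1', h2', h3'⟩ := hγ (i + 1) 0 hi
      refine IsBi.linked_of_level hm (lo := base + i * (6 * s) + s)
        (hi := base + (i + 1) * (6 * s) + 2 * s - 1) (fun l h4 h5 => hturn i hi 0 l h4 h5 ?_)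
        h3 h3' ⟨by omega, by omega⟩ ⟨by omega, by omega⟩
      intro X hX
      have c1 := hX.symm.card_inter_le w.upperHalf
      rw [below_zero_inter_upperHalf (by omega)] at c1
      rw [if_neg hev]
      unfold progress
      omega
  have hall : ∀ i ≤ r, w.Linked χ P (w.below 0 (γ 0 0)) (w.below 0 (γ i 0)) := by
    intro i
    induction i with
    | zero => exact fun _ => Linked.refl _
    | succ i ih => exact fun hi => (ih (by omega)).trans (hnext i hi)
  obtain ⟨k, F, hinj, h0, hk, hR⟩ := (hall r le_rfl).1.exists_path
  refine ⟨k, F, hinj, fun j hj => (hR j hj).2.2, ?_⟩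
  have hlip : ∀ j ≤ k, snake (6 * s) K ((F j).card - base) (w.progress s K (F j)) ≤
      snake (6 * s) K ((F 0).card - base) (w.progress s K (F 0)) + j := by
    intro j
    induction j with
    | zero => simp
    | succ j ih =>
      intro hj
      have h1 := ih (by omega)
      obtain ⟨p1, p2, hst⟩ := hR j (by omega)
      have := hst.snake_le (by omega) p1 p2
      omega
  have hend := hlip k le_rfl
  rw [hk, h0] at hend
  have hst : snake (6 * s) K ((w.below 0 (γ 0 0)).card - base)
      (w.progress s K (w.below 0 (γ 0 0))) ≤ K := by
    obtain ⟨h1, h2, -⟩ := hγ 0 0 (by omega)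
    have := hstrip 0 (by omega)
    rw [card_below _ (by omega)]
    unfold snake
    rw [Nat.div_eq_of_lt (by omega)]
    simp [progress]
  have hfin : r * K ≤ snake (6 * s) K ((w.below 0 (γ r 0)).card - base)
      (w.progress s K (w.below 0 (γ r 0))) := by
    obtain ⟨h1, h2, -⟩ := hγ r 0 le_rfl
    rw [card_below _ (by omega)]
    unfold snake
    rw [Nat.div_eq_of_lt_le (k := r) (by omega)
      (by rw [show (r + 1) * (6 * s) = r * (6 * s) + 6 * s by ring]; omega)]
    exact Nat.le_add_right _ _
  rw [Nat.sub_mul, one_mul]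
  omega

end Wiring

/-! ### Wiring diagrams and faces of arrangements -/

open Filter Topology in
/-- Columns around the points of a finite set: between two consecutive columns there is at most one
of the points. -/
theorem exists_columns (S : Finset ℝ) : ∀ M : ℝ, (∀ a ∈ S, a < M) →
    ∃ x : ℕ → ℝ, Monotone x ∧ (∀ t, x t ∉ S) ∧ (∀ a ∈ S, x 0 < a) ∧
      (∀ t, S.card ≤ t → x t = M) ∧
      ∀ t, ∀ a ∈ S, ∀ a' ∈ S, x t < a → a < x (t + 1) → x t < a' → a' < x (t + 1) → a = a' := by
  induction S using Finset.induction_on_max with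
  | empty => exact fun M _ => ⟨fun _ => M, monotone_const, by simp, by simp, by simp, by simp⟩
  | insert c S hc ih =>
    intro M hM
    obtain ⟨M', hM', hcM'⟩ : ∃ M', (∀ a ∈ S, a < M') ∧ M' < c := by
      have h : ∀ᶠ y in 𝓝[<] c, ∀ a ∈ S, a < y :=
        (Finset.eventually_all S).2 fun a ha => nhdsWithin_le_nhds (eventually_gt_nhds (hc a ha))
      exact (h.and self_mem_nhdsWithin).exists
    obtain ⟨x, hmono, hnot, hlt, hlast, huniq⟩ := ih M' hM'
    have hcS : c ∉ S := fun h => lt_irrefl _ (hc c h)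
    have hcM : c < M := hM c (Finset.mem_insert_self _ _)
    have hxM' : ∀ t, x t ≤ M' := fun t => by
      rcases le_total S.card t with h | h
      · exact (hlast t h).le
      · exact (hmono h).trans (hlast _ le_rfl).le
    refine ⟨fun t => if t ≤ S.card then x t else M, ?_, ?_, ?_, ?_, ?_⟩
    · intro t t' htt
      by_cases h : t ≤ S.card <;> by_cases h' : t' ≤ S.card <;> simp only [h, h', if_true, if_false]
      · exact hmono htt
      · have := hxM' t; linarith
      · omega
      · exact le_rfl
    · intro t
      have h1 := hxM' t
      by_cases h : t ≤ S.card <;> simp only [h, if_true, if_false, Finset.mem_insert, not_or]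
      · exact ⟨by linarith, hnot t⟩
      · exact ⟨hcM.ne', fun hMS => lt_irrefl _ (hM M (Finset.mem_insert_of_mem hMS))⟩
    · intro a ha
      simp only [Nat.zero_le, if_true]
      rcases Finset.mem_insert.1 ha with rfl | ha
      · exact lt_of_le_of_lt (hxM' 0) hcM'
      · exact hlt a ha
    · intro t ht
      rw [Finset.card_insert_of_notMem hcS] at ht
      simp only [show ¬ t ≤ S.card by omega, if_false]
    · intro t
      rcases lt_trichotomy t S.card with h | h | h
      · simp only [show t ≤ S.card by omega, show t + 1 ≤ S.card by omega, if_true]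
        have key : ∀ a ∈ insert c S, a < x (t + 1) → a ∈ S := fun a ha hlt => by
          rcases Finset.mem_insert.1 ha with rfl | ha
          · have := hxM' (t + 1); linarith
          · exact ha
        intro a ha a' ha' h1 h2 h3 h4
        exact huniq t a (key a ha h2) a' (key a' ha' h4) h1 h2 h3 h4
      · subst h
        simp only [le_refl, if_true, show ¬ S.card + 1 ≤ S.card by omega, if_false]
        rw [hlast _ le_rfl]
        have key : ∀ a ∈ insert c S, M' < a → a = c := fun a ha hlt => by
          rcases Finset.mem_insert.1 ha with rfl | ha
          · rfl
          · have := hM' a ha; linarith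
        intro a ha a' ha' h1 _ h3 _
        rw [key a ha h1, key a' ha' h3]
      · simp only [show ¬ t ≤ S.card by omega, show ¬ t + 1 ≤ S.card by omega, if_false]
        intro a ha a' ha' h1 h2
        linarith

/-- A continuous function without zeros on a preconnected set has constant sign there. -/
theorem IsPreconnected.neg_of_neg {α : Type*} [TopologicalSpace α] {s : Set α}
    (hs : IsPreconnected s) {g : α → ℝ} (hg : Continuous g) (h0 : ∀ p ∈ s, g p ≠ 0) {a b : α}
    (ha : a ∈ s) (hb : b ∈ s) (hneg : g a < 0) : g b < 0 := by
  by_contra hcon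
  obtain ⟨p, hp, hp0⟩ := hs.intermediate_value ha hb hg.continuousOn ⟨hneg.le, not_lt.1 hcon⟩
  exact h0 p hp hp0

namespace PseudolineArrangement

variable {n : ℕ} (A : PseudolineArrangement n)

/-- The number of pseudolines below the `i`-th one at abscissa `x`. -/
noncomputable def rank (x : ℝ) (i : Fin n) : ℕ :=
  (Finset.univ.filter fun j => A.curve j x < A.curve i x).card

theorem rank_lt_rank {x : ℝ} {i j : Fin n} (h : A.curve i x < A.curve j x) :
    A.rank x i < A.rank x j := by
  apply Finset.card_lt_card
  rw [Finset.ssubset_iff_of_subset]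
  · exact ⟨i, by simpa using h, by simp⟩
  · intro l
    simp only [Finset.mem_filter, Finset.mem_univ, true_and]
    exact fun hl => hl.trans h

theorem rank_le_rank {x : ℝ} {i j : Fin n} (h : A.curve i x ≤ A.curve j x) :
    A.rank x i ≤ A.rank x j := by
  apply Finset.card_le_card
  intro l
  simp only [Finset.mem_filter, Finset.mem_univ, true_and]
  exact fun hl => hl.trans_le h

theorem rank_lt_rank_iff {x : ℝ} {i j : Fin n} :
    A.rank x i < A.rank x j ↔ A.curve i x < A.curve j x :=
  ⟨fun h => by
    by_contra hcon
    exact absurd (A.rank_le_rank (not_lt.1 hcon)) (not_le.2 h), A.rank_lt_rank⟩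

theorem rank_lt (x : ℝ) (i : Fin n) : A.rank x i < n := by
  have := Finset.card_lt_univ_of_notMem
    (s := Finset.univ.filter fun j => A.curve j x < A.curve i x) (x := i) (by simp)
  rwa [Fintype.card_fin] at this

variable {A}

theorem exists_crossing_between {x y : ℝ} {i j : Fin n}
    (hx : A.curve i x < A.curve j x) (hy : A.curve j y < A.curve i y) (hxy : x ≤ y) :
    ∃ c, x < c ∧ c < y ∧ A.curve i c = A.curve j c := by
  have hij : i ≠ j := fun h => by subst h; exact lt_irrefl _ hx
  obtain ⟨c, hc, ⟨h1, h2⟩ | ⟨h1, h2⟩⟩ := A.cross i j hij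
  · refine ⟨c, ?_, ?_, hc⟩
    · rcases lt_trichotomy x c with h | rfl | h
      · exact h
      · linarith
      · have := h2 x h; linarith
    · rcases lt_trichotomy c y with h | rfl | h
      · exact h
      · linarith
      · have := h1 y h; linarith
  · have hxc : c < x := by
      rcases lt_trichotomy x c with h | rfl | h
      · have := h1 x h; linarith
      · linarith
      · exact h
    have := h2 y (hxc.trans_le hxy)
    linarith

/-- Between two abscissae that are separated by at most one crossing abscissa, a pseudoline of a
simple arrangement meets at most one other. -/
theorem IsSimple.rank_le (hA : A.IsSimple) {x y : ℝ}
    (hxy : ∀ i j c i' j' c', i ≠ j → i' ≠ j' → A.curve i c = A.curve j c →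
      A.curve i' c' = A.curve j' c' → x < c → c < y → x < c' → c' < y → c = c')
    (hle : x ≤ y) (hx : ∀ i j, i ≠ j → A.curve i x ≠ A.curve j x)
    (hy : ∀ i j, i ≠ j → A.curve i y ≠ A.curve j y) (i : Fin n) :
    A.rank y i ≤ A.rank x i + 1 ∧ A.rank x i ≤ A.rank y i + 1 := by
  have key : ∀ j j', j ≠ i → j' ≠ i →
      (∃ c, x < c ∧ c < y ∧ A.curve j c = A.curve i c) →
      (∃ c, x < c ∧ c < y ∧ A.curve j' c = A.curve i c) → j = j' := by
    rintro j j' hj hj' ⟨c, h1, h2, h3⟩ ⟨c', h1', h2', h3'⟩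
    obtain rfl := hxy _ _ _ _ _ _ hj hj' h3 h3' h1 h2 h1' h2'
    by_contra hne
    exact hA j i j' hj hj'.symm hne c ⟨h3, h3'.symm⟩
  constructor
  · have hsub : (Finset.univ.filter fun j => A.curve j y < A.curve i y) ⊆
        (Finset.univ.filter fun j => A.curve j x < A.curve i x) ∪
        (Finset.univ.filter fun j => A.curve i x < A.curve j x ∧ A.curve j y < A.curve i y) := by
      intro j
      simp only [Finset.mem_filter, Finset.mem_univ, true_and, Finset.mem_union]
      intro hj
      have hji : j ≠ i := fun h => by subst h; exact lt_irrefl _ hj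
      rcases lt_or_gt_of_ne (hx j i hji) with h | h
      · exact Or.inl h
      · exact Or.inr ⟨h, hj⟩
    refine ((Finset.card_le_card hsub).trans (Finset.card_union_le _ _)).trans
      (Nat.add_le_add_left (Finset.card_le_one.2 ?_) _)
    intro j hj j' hj'
    simp only [Finset.mem_filter, Finset.mem_univ, true_and] at hj hj'
    have hji : j ≠ i := fun h => by subst h; exact lt_irrefl _ hj.1
    have hji' : j' ≠ i := fun h => by subst h; exact lt_irrefl _ hj'.1
    obtain ⟨c, h1, h2, h3⟩ := exists_crossing_between hj.1 hj.2 hle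
    obtain ⟨c', h1', h2', h3'⟩ := exists_crossing_between hj'.1 hj'.2 hle
    exact key j j' hji hji' ⟨c, h1, h2, h3.symm⟩ ⟨c', h1', h2', h3'.symm⟩
  · have hsub : (Finset.univ.filter fun j => A.curve j x < A.curve i x) ⊆
        (Finset.univ.filter fun j => A.curve j y < A.curve i y) ∪
        (Finset.univ.filter fun j => A.curve j x < A.curve i x ∧ A.curve i y < A.curve j y) := by
      intro j
      simp only [Finset.mem_filter, Finset.mem_univ, true_and, Finset.mem_union]
      intro hj
      have hji : j ≠ i := fun h => by subst h; exact lt_irrefl _ hj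
      rcases lt_or_gt_of_ne (hy j i hji) with h | h
      · exact Or.inl h
      · exact Or.inr ⟨hj, h⟩
    refine ((Finset.card_le_card hsub).trans (Finset.card_union_le _ _)).trans
      (Nat.add_le_add_left (Finset.card_le_one.2 ?_) _)
    intro j hj j' hj'
    simp only [Finset.mem_filter, Finset.mem_univ, true_and] at hj hj'
    have hji : j ≠ i := fun h => by subst h; exact lt_irrefl _ hj.1
    have hji' : j' ≠ i := fun h => by subst h; exact lt_irrefl _ hj'.1
    exact key j j' hji hji' (exists_crossing_between hj.1 hj.2 hle)
      (exists_crossing_between hj'.1 hj'.2 hle)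

/-- A simple arrangement has a wiring diagram, whose columns are the vertical orders of the
pseudolines at abscissae on either side of the crossings. -/
theorem IsSimple.exists_wiring (hA : A.IsSimple) :
    ∃ (w : Wiring n) (x : ℕ → ℝ), (∀ t i j, i ≠ j → A.curve i (x t) ≠ A.curve j (x t)) ∧
      (∀ t i, w.pos t i = A.rank (x t) i) ∧ w.T ≤ n ^ 2 := by
  classical
  set S : Finset ℝ := Finset.univ.image fun p : Fin n × Fin n =>
    if h : p.1 ≠ p.2 then (A.cross p.1 p.2 h).choose else 0 with hSdef
  have hcard : S.card ≤ n ^ 2 := Finset.card_image_le.trans (by simp [sq])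
  have hS : ∀ i j c, i ≠ j → A.curve i c = A.curve j c → c ∈ S := by
    intro i j c hij hc
    rw [hSdef, Finset.mem_image]
    refine ⟨(i, j), Finset.mem_univ _, ?_⟩
    rw [dif_pos hij]
    obtain ⟨h0, h⟩ := (A.cross i j hij).choose_spec
    set d := (A.cross i j hij).choose
    rcases lt_trichotomy c d with hlt | heq | hlt
    · rcases h with h | h <;> have := h.1 c hlt <;> linarith
    · exact heq.symm
    · rcases h with h | h <;> have := h.2 c hlt <;> linarith
  obtain ⟨M, hM⟩ := S.finite_toSet.bddAbove
  obtain ⟨x, hmono, hnot, hlt, hlast, huniq⟩ := exists_columns S (M + 1) fun a ha => by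
    have := hM ha; linarith
  have hgen : ∀ t i j, i ≠ j → A.curve i (x t) ≠ A.curve j (x t) := fun t i j hij h =>
    hnot t (hS i j _ hij h)
  refine ⟨⟨S.card, fun t => A.rank (x t), fun t => A.rank_lt (x t), ?_, ?_, ?_, ?_⟩, x, hgen,
    fun _ _ => rfl, hcard⟩
  · intro t i j h
    by_contra hij
    rcases lt_or_gt_of_ne (hgen t i j hij) with hl | hl <;>
      have := A.rank_lt_rank hl <;> omega
  · intro t i
    exact hA.rank_le (fun i j c i' j' c' hij hij' hc hc' h1 h2 h3 h4 =>
      huniq t c (hS i j c hij hc) c' (hS i' j' c' hij' hc') h1 h2 h3 h4)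
      (hmono (Nat.le_succ t)) (hgen t) (hgen (t + 1)) i
  · intro t ht
    show A.rank (x t) = A.rank (x S.card)
    rw [hlast t ht, hlast _ le_rfl]
  · intro i j hij
    rw [rank_lt_rank_iff] at hij ⊢
    have hne : i ≠ j := fun h => by subst h; exact lt_irrefl _ hij
    obtain ⟨c, hc, h⟩ := A.cross i j hne
    have hcS := hS i j c hne hc
    have h0 := hlt c hcS
    have h1 : c < x S.card := by
      rw [hlast _ le_rfl]
      have := hM hcS; linarith
    rcases h with h | h
    · exact h.2 _ h1
    · have := h.1 _ h0
      linarith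

variable (A)

/-- The points of the plane with sign vector `B`: above the pseudolines in `B` and below the
others. -/
def cell (B : Finset (Fin n)) : Set (ℝ × ℝ) :=
  {p | ∀ i, (i ∈ B → A.curve i p.1 < p.2) ∧ (i ∉ B → p.2 < A.curve i p.1)}

theorem ordConnected_setOf_lt (i j : Fin n) :
    Set.OrdConnected {x | A.curve i x < A.curve j x} := by
  refine ⟨fun x hx y hy z hz => ?_⟩
  by_contra hcon
  simp only [Set.mem_ofPred_eq, not_lt] at hcon hx hy
  have hij : i ≠ j := fun h => by subst h; exact lt_irrefl _ hx
  obtain ⟨c, hc, ⟨h1, h2⟩ | ⟨h1, h2⟩⟩ := A.cross i j hij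
  · have hyc : y < c := by
      by_contra h
      rcases (not_lt.1 h).eq_or_lt with rfl | h
      · linarith
      · have := h2 y h; linarith
    have := h1 z (hz.2.trans_lt hyc)
    linarith
  · have hxc : c < x := by
      by_contra h
      rcases (not_lt.1 h).eq_or_lt with rfl | h
      · linarith
      · have := h1 x h; linarith
    have := h2 z (hxc.trans_le hz.1)
    linarith

/-- A continuous curve that runs between the pseudolines in `B` and the others wherever this is
possible. -/
theorem exists_curve_between (B : Finset (Fin n)) : ∃ m : ℝ → ℝ, Continuous m ∧
    ∀ x, (∀ i ∈ B, ∀ j ∉ B, A.curve i x < A.curve j x) → (x, m x) ∈ A.cell B := by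
  have hcont := A.continuous_curve
  rcases B.eq_empty_or_nonempty with rfl | hB
  · rcases (Finset.univ : Finset (Fin n)).eq_empty_or_nonempty with hU | hU
    · refine ⟨fun _ => 0, continuous_const, fun x _ i => ?_⟩
      exact absurd (Finset.mem_univ i) (by simp [hU])
    · refine ⟨fun x => Finset.univ.inf' hU (fun i => A.curve i x) - 1, ?_, fun x _ i => ?_⟩
      · exact (Continuous.finset_inf'_apply hU fun i _ => hcont i).sub continuous_const
      · refine ⟨by simp, fun _ => ?_⟩
        have := Finset.inf'_le (fun i => A.curve i x) (Finset.mem_univ i)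
        simp only
        linarith
  · rcases (Bᶜ).eq_empty_or_nonempty with hC | hC
    · refine ⟨fun x => B.sup' hB (fun i => A.curve i x) + 1, ?_, fun x _ i => ?_⟩
      · exact (Continuous.finset_sup'_apply hB fun i _ => hcont i).add continuous_const
      · refine ⟨fun hi => ?_, fun hi => ?_⟩
        · have := Finset.le_sup' (fun i => A.curve i x) hi
          simp only
          linarith
        · have : i ∈ Bᶜ := Finset.mem_compl.2 hi
          simp [hC] at this
    · refine ⟨fun x => (B.sup' hB (fun i => A.curve i x) + Bᶜ.inf' hC (fun i => A.curve i x)) / 2,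
        ?_, fun x hx i => ?_⟩
      · exact ((Continuous.finset_sup'_apply hB fun i _ => hcont i).add
          (Continuous.finset_inf'_apply hC fun i _ => hcont i)).div_const 2
      · have hlt : B.sup' hB (fun i => A.curve i x) < Bᶜ.inf' hC (fun i => A.curve i x) := by
          rw [Finset.sup'_lt_iff]
          intro i hi
          rw [Finset.lt_inf'_iff]
          exact fun j hj => hx i hi j (Finset.mem_compl.1 hj)
        refine ⟨fun hi => ?_, fun hi => ?_⟩
        · have := Finset.le_sup' (fun i => A.curve i x) hi
          simp only at *
          linarith
        · have := Finset.inf'_le (fun i => A.curve i x) (Finset.mem_compl.2 hi)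
          simp only at *
          linarith

theorem isPreconnected_cell (B : Finset (Fin n)) : IsPreconnected (A.cell B) := by
  obtain ⟨m, hm, hmB⟩ := A.exists_curve_between B
  set I : Set ℝ := ⋂ i ∈ B, ⋂ j ∈ {j | j ∉ B}, {x | A.curve i x < A.curve j x} with hI
  have hIord : I.OrdConnected :=
    Set.ordConnected_biInter fun i _ => Set.ordConnected_biInter fun j _ =>
      A.ordConnected_setOf_lt i j
  have hmem : ∀ x, x ∈ I ↔ ∀ i ∈ B, ∀ j ∉ B, A.curve i x < A.curve j x := by
    intro x; simp [hI]
  have hproj : ∀ p ∈ A.cell B, p.1 ∈ I := by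
    intro p hp
    rw [hmem]
    exact fun i hi j hj => ((hp i).1 hi).trans ((hp j).2 hj)
  -- the cell is the union of the graph of `m` over `I` and of vertical segments that meet it
  set G : Set (ℝ × ℝ) := (fun x => (x, m x)) '' I with hG
  have hGpre : IsPreconnected G :=
    hIord.isPreconnected.image _ (by fun_prop)
  have hGsub : G ⊆ A.cell B := by
    rintro _ ⟨x, hx, rfl⟩
    exact hmB x ((hmem x).1 hx)
  have hseg : ∀ p ∈ A.cell B, ∃ V ⊆ A.cell B, IsPreconnected V ∧ p ∈ V ∧ (p.1, m p.1) ∈ V := by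
    intro p hp
    have hq := hmB p.1 ((hmem _).1 (hproj p hp))
    refine ⟨(fun y => (p.1, y)) '' Set.uIcc p.2 (m p.1), ?_,
      isPreconnected_uIcc.image _ (by fun_prop), ⟨p.2, Set.left_mem_uIcc, rfl⟩,
      ⟨m p.1, Set.right_mem_uIcc, rfl⟩⟩
    rintro _ ⟨y, hy, rfl⟩ i
    rw [Set.mem_uIcc] at hy
    have h1 := hp i
    have h2 := hq i
    simp only at *
    refine ⟨fun hi => ?_, fun hi => ?_⟩
    · have := h1.1 hi; have := h2.1 hi
      rcases hy with hy | hy <;> linarith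
    · have := h1.2 hi; have := h2.2 hi
      rcases hy with hy | hy <;> linarith
  refine isPreconnected_of_forall_pair fun p hp q hq => ?_
  obtain ⟨V, hV, hVpre, hpV, hmV⟩ := hseg p hp
  obtain ⟨V', hV', hVpre', hqV', hmV'⟩ := hseg q hq
  have g1 : (p.1, m p.1) ∈ G := ⟨p.1, hproj p hp, rfl⟩
  have g2 : (q.1, m q.1) ∈ G := ⟨q.1, hproj q hq, rfl⟩
  exact ⟨V ∪ G ∪ V', Set.union_subset (Set.union_subset hV hGsub) hV', Or.inl (Or.inl hpV),
    Or.inr hqV', (hVpre.union _ hmV g1 hGpre).union _ (Or.inr g2) hmV' hVpre'⟩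

/-- Nonempty cells are faces. -/
theorem isFace_cell {B : Finset (Fin n)} (h : (A.cell B).Nonempty) : A.IsFace (A.cell B) := by
  obtain ⟨p, hp⟩ := h
  have hsub : A.cell B ⊆ (⋃ i, A.line i)ᶜ := by
    intro q hq
    simp only [Set.mem_compl_iff, Set.mem_iUnion, not_exists, line, Set.mem_ofPred_eq]
    intro i hi
    by_cases hiB : i ∈ B
    · have := (hq i).1 hiB; linarith
    · have := (hq i).2 hiB; linarith
  refine ⟨p, hsub hp, Set.Subset.antisymm
    ((A.isPreconnected_cell B).subset_connectedComponentIn hp hsub) ?_⟩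
  intro q hq i
  have hpre := isPreconnected_connectedComponentIn (F := (⋃ i, A.line i)ᶜ) (x := p)
  have hpp := mem_connectedComponentIn (hsub hp)
  have hcont := A.continuous_curve i
  have h0 : ∀ r ∈ connectedComponentIn (⋃ i, A.line i)ᶜ p, r.2 ≠ A.curve i r.1 := by
    intro r hr hri
    exact connectedComponentIn_subset _ _ hr (Set.mem_iUnion.2 ⟨i, hri⟩)
  refine ⟨fun hi => ?_, fun hi => ?_⟩
  · have := hpre.neg_of_neg (g := fun r => A.curve i r.1 - r.2) (by fun_prop)
      (fun r hr => sub_ne_zero.2 (h0 r hr).symm) hpp hq (sub_neg.2 ((hp i).1 hi))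
    exact sub_neg.1 this
  · have := hpre.neg_of_neg (g := fun r => r.2 - A.curve i r.1) (by fun_prop)
      (fun r hr => sub_ne_zero.2 (h0 r hr)) hpp hq (sub_neg.2 ((hp i).2 hi))
    exact sub_neg.1 this

theorem cell_injective {B B' : Finset (Fin n)} (h : (A.cell B).Nonempty)
    (heq : A.cell B = A.cell B') : B = B' := by
  obtain ⟨p, hp⟩ := h
  have hp' : p ∈ A.cell B' := heq ▸ hp
  ext i
  have h1 := hp i
  have h2 := hp' i
  by_contra hcon
  by_cases hi : i ∈ B
  · have := h1.1 hi
    have := h2.2 fun h => hcon ⟨fun _ => h, fun _ => hi⟩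
    linarith
  · have := h1.2 hi
    have := h2.1 (by by_contra h; exact hcon ⟨fun h' => absurd h' hi, fun h' => absurd h' h⟩)
    linarith

open Filter Topology in
/-- The edge on the `i`-th pseudoline at abscissa `x` is on the boundary of the faces just below and
just above it. -/
theorem exists_isEdge (i : Fin n) {x : ℝ} (hx : ∀ j, j ≠ i → A.curve j x ≠ A.curve i x)
    {X Y : Finset (Fin n)} (hX : ∀ j, j ∈ X ↔ A.curve j x < A.curve i x)
    (hY : ∀ j, j ∈ Y ↔ A.curve j x ≤ A.curve i x) :
    ∃ e, A.IsEdge i e ∧ e.Nonempty ∧ e ⊆ closure (A.cell X) ∧ e ⊆ closure (A.cell Y) := by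
  set C : Set (ℝ × ℝ) := A.line i \ ⋃ j ∈ {j : Fin n | j ≠ i}, A.line j with hC
  have hmemC : ∀ q, q ∈ C ↔ q.2 = A.curve i q.1 ∧ ∀ j, j ≠ i → q.2 ≠ A.curve j q.1 := by
    intro q; simp [hC, line]
  have hp : ((x, A.curve i x) : ℝ × ℝ) ∈ C :=
    (hmemC _).2 ⟨rfl, fun j hj h => hx j hj h.symm⟩
  have hpre := isPreconnected_connectedComponentIn (F := C) (x := (x, A.curve i x))
  have hpp := mem_connectedComponentIn hp
  have hlt : ∀ q ∈ connectedComponentIn C (x, A.curve i x), ∀ j, A.curve j x < A.curve i x →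
      A.curve j q.1 < A.curve i q.1 := by
    intro q hq j hj
    have hji : j ≠ i := fun h => by subst h; exact lt_irrefl _ hj
    have hcont := A.continuous_curve j
    have := hpre.neg_of_neg (g := fun r => A.curve j r.1 - r.2) (by fun_prop)
      (fun r hr => sub_ne_zero.2
        (((hmemC r).1 (connectedComponentIn_subset _ _ hr)).2 j hji).symm) hpp hq (sub_neg.2 hj)
    rw [← ((hmemC q).1 (connectedComponentIn_subset _ _ hq)).1]
    exact sub_neg.1 this
  have hgt : ∀ q ∈ connectedComponentIn C (x, A.curve i x), ∀ j, A.curve i x < A.curve j x →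
      A.curve i q.1 < A.curve j q.1 := by
    intro q hq j hj
    have hji : j ≠ i := fun h => by subst h; exact lt_irrefl _ hj
    have hcont := A.continuous_curve j
    have := hpre.neg_of_neg (g := fun r => r.2 - A.curve j r.1) (by fun_prop)
      (fun r hr => sub_ne_zero.2
        (((hmemC r).1 (connectedComponentIn_subset _ _ hr)).2 j hji)) hpp hq (sub_neg.2 hj)
    rw [← ((hmemC q).1 (connectedComponentIn_subset _ _ hq)).1]
    exact sub_neg.1 this
  refine ⟨connectedComponentIn C (x, A.curve i x), ⟨_, hp, rfl⟩, ⟨_, hpp⟩, ?_, ?_⟩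
  · intro q hq
    have hq2 := ((hmemC q).1 (connectedComponentIn_subset _ _ hq)).1
    have htend : Tendsto (fun y : ℝ => (q.1, y)) (𝓝[<] q.2) (𝓝 q) :=
      (Continuous.tendsto (by fun_prop : Continuous fun y : ℝ => (q.1, y)) q.2).mono_left
        nhdsWithin_le_nhds
    refine mem_closure_of_tendsto htend ?_
    refine eventually_all.2 fun j => ?_
    by_cases hj : j ∈ X
    · have h1 := hlt q hq j ((hX j).1 hj)
      filter_upwards [nhdsWithin_le_nhds (eventually_gt_nhds (hq2 ▸ h1))] with y hy
      exact ⟨fun _ => hy, fun h => absurd hj h⟩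
    · have h1 : q.2 ≤ A.curve j q.1 := by
        by_cases hji : j = i
        · rw [hji, hq2]
        · rw [hq2]
          exact (hgt q hq j (lt_of_le_of_ne (not_lt.1 ((hX j).not.1 hj)) (hx j hji).symm)).le
      filter_upwards [self_mem_nhdsWithin] with y hy
      exact ⟨fun h => absurd h hj, fun _ => lt_of_lt_of_le hy h1⟩
  · intro q hq
    have hq2 := ((hmemC q).1 (connectedComponentIn_subset _ _ hq)).1
    have htend : Tendsto (fun y : ℝ => (q.1, y)) (𝓝[>] q.2) (𝓝 q) :=
      (Continuous.tendsto (by fun_prop : Continuous fun y : ℝ => (q.1, y)) q.2).mono_left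
        nhdsWithin_le_nhds
    refine mem_closure_of_tendsto htend ?_
    refine eventually_all.2 fun j => ?_
    by_cases hj : j ∈ Y
    · have h1 : A.curve j q.1 ≤ q.2 := by
        by_cases hji : j = i
        · rw [hji, hq2]
        · rw [hq2]
          exact (hlt q hq j (lt_of_le_of_ne ((hY j).1 hj) (hx j hji))).le
      filter_upwards [self_mem_nhdsWithin] with y hy
      exact ⟨fun _ => lt_of_le_of_lt h1 hy, fun h => absurd hj h⟩
    · have h1 := hgt q hq j (not_le.1 ((hY j).not.1 hj))
      filter_upwards [nhdsWithin_le_nhds (eventually_lt_nhds (hq2 ▸ h1))] with y hy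
      exact ⟨fun h => absurd h hj, fun _ => hy⟩

/-- Every coloring admits the path that consists of a single face. -/
theorem hasAlternatingPath_of_le_one (χ : Fin n → Bool) {L : ℝ} (hL : L ≤ 1) :
    A.HasAlternatingPath χ L := by
  obtain ⟨y, hy⟩ := (Set.finite_range fun i => A.curve i 0).bddBelow
  have hne : (A.cell ∅).Nonempty := by
    refine ⟨(0, y - 1), fun i => ⟨by simp, fun _ => ?_⟩⟩
    have : y ≤ A.curve i 0 := hy ⟨i, rfl⟩
    simp only
    linarith
  exact ⟨0, fun _ => A.cell ∅, Fin.elim0, Fin.elim0,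
    ⟨fun _ => A.isFace_cell hne, fun a b _ => Fin.ext (by omega), fun j => j.elim0,
      fun j => j.elim0, fun j => j.elim0⟩, fun j => j.elim0, by simpa using hL⟩

variable {A}

/-- Paths in the oriented dual graph of the wiring diagram are alternating dual paths. -/
theorem hasAlternatingPath_of_steps {w : Wiring n} {x : ℕ → ℝ}
    (hgen : ∀ t i j, i ≠ j → A.curve i (x t) ≠ A.curve j (x t))
    (hpos : ∀ t i, w.pos t i = A.rank (x t) i) {χ : Fin n → Bool} {k : ℕ}
    {F : ℕ → Finset (Fin n)} (hinj : Set.InjOn F (Set.Iic k))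
    (hstep : ∀ j < k, w.Step χ (F j) (F (j + 1))) : A.HasAlternatingPath χ (k + 1) := by
  rcases Nat.eq_zero_or_pos k with rfl | hk0
  · exact A.hasAlternatingPath_of_le_one χ (by simp)
  have hacross : ∀ {i X Y}, w.Across i X Y → ∃ e, A.IsEdge i e ∧ e.Nonempty ∧
      e ⊆ closure (A.cell X) ∧ e ⊆ closure (A.cell Y) := by
    rintro i X Y ⟨t, rfl, rfl⟩
    refine A.exists_isEdge i (fun j hj => hgen t j i hj) (fun j => ?_) (fun j => ?_)
    · rw [Wiring.mem_below, hpos, hpos, rank_lt_rank_iff]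
    · rw [Wiring.mem_below, hpos, hpos, Nat.lt_succ_iff, ← not_lt, rank_lt_rank_iff, not_lt]
  have hedge : ∀ j, ∃ (i : Fin n) (e : Set (ℝ × ℝ)), j < k →
      (χ i = true ↔ Even (F j).card) ∧ A.IsEdge i e ∧ e.Nonempty ∧
      e ⊆ closure (A.cell (F j)) ∧ e ⊆ closure (A.cell (F (j + 1))) := by
    intro j
    by_cases hj : j < k
    · obtain ⟨i, h | h, hχ⟩ := hstep j hj
      · obtain ⟨e, h1, h2, h3, h4⟩ := hacross h
        exact ⟨i, e, fun _ => ⟨hχ, h1, h2, h3, h4⟩⟩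
      · obtain ⟨e, h1, h2, h3, h4⟩ := hacross h
        exact ⟨i, e, fun _ => ⟨hχ, h1, h2, h4, h3⟩⟩
    · obtain ⟨i, -⟩ := hstep 0 hk0
      exact ⟨i, ∅, fun h => absurd h hj⟩
  choose ℓ e he using hedge
  have hne : ∀ j ≤ k, (A.cell (F j)).Nonempty := by
    intro j hj
    rcases hj.eq_or_lt with rfl | hj
    · obtain ⟨-, -, h2, -, h4⟩ := he (j - 1) (by omega)
      rw [Nat.sub_add_cancel hk0] at h4
      exact closure_nonempty_iff.1 (h2.mono h4)
    · obtain ⟨-, -, h2, h3, -⟩ := he j hj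
      exact closure_nonempty_iff.1 (h2.mono h3)
  refine ⟨k, fun j => A.cell (F j), fun j => ℓ j, fun j => e j,
    ⟨fun j => A.isFace_cell (hne j (by omega)), fun a b hab => ?_, fun j => (he j j.2).2.1,
      fun j => (he j j.2).2.2.2.1, fun j => (he j j.2).2.2.2.2⟩, fun i j hij => ?_, le_rfl⟩
  · have h1 : F a = F b := A.cell_injective (hne a (by omega)) hab
    exact Fin.ext (hinj (by simp only [Set.mem_Iic]; omega) (by simp only [Set.mem_Iic]; omega) h1)
  · have h1 := (he i i.2).1
    have h2 := (he j j.2).1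
    have h3 : Even (F j).card ↔ ¬ Even (F i).card := by
      rw [hij]
      obtain ⟨a, ⟨ha, h⟩ | ⟨ha, h⟩⟩ := (hstep i i.2).insert
      · rw [h, Finset.card_insert_of_notMem ha, Nat.even_add_one]
      · rw [h, Finset.card_insert_of_notMem ha, Nat.even_add_one, not_not]
    intro h
    rw [h, h2, h3] at h1
    tauto

theorem HasAlternatingPath.mono {χ : Fin n → Bool} {L L' : ℝ} (h : A.HasAlternatingPath χ L)
    (hL : L' ≤ L) : A.HasAlternatingPath χ L' := by
  obtain ⟨k, F, ℓ, e, h1, h2, h3⟩ := h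
  exact ⟨k, F, ℓ, e, h1, h2, hL.trans h3⟩

end PseudolineArrangement

/-! ### Random colorings -/

/-- All lines of a given set of at least `m` lines get color `b` with probability at most `2⁻ᵐ`. -/
theorem card_monochromatic_mul_le {n m : ℕ} (D : Finset (Fin n)) (hD : m ≤ D.card) (b : Bool) :
    (Finset.univ.filter fun χ : Fin n → Bool => ∀ i ∈ D, χ i = b).card * 2 ^ m ≤ 2 ^ n := by
  have h1 : (Finset.univ.filter fun χ : Fin n → Bool => ∀ i ∈ D, χ i = b) =
      Fintype.piFinset fun i => if i ∈ D then {b} else Finset.univ := by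
    ext χ
    simp only [Finset.mem_filter, Finset.mem_univ, true_and, Fintype.mem_piFinset]
    refine forall_congr' fun i => ?_
    by_cases hi : i ∈ D <;> simp [hi]
  have h2 : ∀ i : Fin n, (if i ∈ D then ({b} : Finset Bool) else Finset.univ).card =
      if i ∈ D then 1 else 2 := by
    intro i; split_ifs <;> simp
  have h3 : (Dᶜ).card = n - D.card := by rw [Finset.card_compl, Fintype.card_fin]
  have h4 : D.card ≤ n := by simpa using D.card_le_univ
  rw [h1, Fintype.card_piFinset, Finset.prod_congr rfl fun i _ => h2 i, Finset.prod_ite,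
    Finset.prod_const_one, one_mul, Finset.prod_const,
    show (Finset.univ.filter fun i => i ∉ D) = Dᶜ by ext; simp, h3, ← pow_add]
  exact Nat.pow_le_pow_right (by norm_num) (by omega)

open Classical in
/-- The union bound for the colorings in which two faces are separated by too many lines of one
color only. -/
theorem Wiring.card_not_mixed_mul_le {n : ℕ} (w : Wiring n) (m : ℕ) :
    (Finset.univ.filter fun χ : Fin n → Bool => ¬ w.Mixed χ m).card * 2 ^ m ≤
      2 * ((w.T + 1) * (n + 1)) ^ 2 * 2 ^ n := by
  set D : (ℕ × ℕ) × (ℕ × ℕ) → Finset (Fin n) := fun q =>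
    w.below q.1.1 q.1.2 \ w.below q.2.1 q.2.2 with hDdef
  set S := Finset.range (w.T + 1) ×ˢ Finset.range (n + 1) with hS
  set I := (((S ×ˢ S) ×ˢ (Finset.univ : Finset Bool)).filter fun q => m ≤ (D q.1).card) with hI
  have hbelow : ∀ t k, w.below t k = w.below (min t w.T) (min k n) := by
    intro t k
    have h1 : w.pos t = w.pos (min t w.T) := by
      rcases le_total t w.T with h | h
      · rw [min_eq_left h]
      · rw [min_eq_right h, w.stable t h]
    have h2 : w.below t k = w.below (min t w.T) k := by
      unfold Wiring.below; rw [h1]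
    rw [h2]
    rcases le_total k n with h | h
    · rw [min_eq_left h]
    · rw [min_eq_right h, Wiring.below_of_le _ h]
  have hmem : ∀ t k, (min t w.T, min k n) ∈ S := by
    intro t k
    simp only [hS, Finset.mem_product, Finset.mem_range]
    omega
  have hsub : (Finset.univ.filter fun χ : Fin n → Bool => ¬ w.Mixed χ m) ⊆
      I.biUnion fun q => Finset.univ.filter fun χ : Fin n → Bool => ∀ i ∈ D q.1, χ i = q.2 := by
    intro χ hχ
    simp only [Finset.mem_filter, Finset.mem_univ, true_and, Wiring.Mixed, not_forall,
      not_lt] at hχ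
    obtain ⟨t, k, t', k', b, hmono, hcard⟩ := hχ
    rw [hbelow t k, hbelow t' k'] at hmono hcard
    refine Finset.mem_biUnion.2 ⟨(((min t w.T, min k n), (min t' w.T, min k' n)), b), ?_, ?_⟩
    · exact Finset.mem_filter.2 ⟨Finset.mem_product.2
        ⟨Finset.mem_product.2 ⟨hmem t k, hmem t' k'⟩, Finset.mem_univ _⟩, hcard⟩
    · exact Finset.mem_filter.2 ⟨Finset.mem_univ _, fun i hi => hmono i hi⟩
  have hIcard : I.card ≤ 2 * ((w.T + 1) * (n + 1)) ^ 2 := by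
    refine (Finset.card_filter_le _ _).trans (le_of_eq ?_)
    simp only [hS, Finset.card_product, Finset.card_range, Finset.card_univ, Fintype.card_bool]
    ring
  calc _ ≤ (∑ q ∈ I, (Finset.univ.filter fun χ : Fin n → Bool =>
          ∀ i ∈ D q.1, χ i = q.2).card) * 2 ^ m :=
        Nat.mul_le_mul_right _ ((Finset.card_le_card hsub).trans Finset.card_biUnion_le)
    _ = ∑ q ∈ I, (Finset.univ.filter fun χ : Fin n → Bool =>
          ∀ i ∈ D q.1, χ i = q.2).card * 2 ^ m := Finset.sum_mul _ _ _
    _ ≤ ∑ q ∈ I, 2 ^ n := Finset.sum_le_sum fun q hq =>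
        card_monochromatic_mul_le _ (Finset.mem_filter.1 hq).2 _
    _ = I.card * 2 ^ n := by rw [Finset.sum_const, smul_eq_mul]
    _ ≤ _ := Nat.mul_le_mul_right _ hIcard

/-- A number of lines, of order `log n`, that is large enough for the union bound. -/
def mixThreshold (n : ℕ) : ℕ := 9 * (Nat.log 2 n + 1)

open Classical in
/-- With high probability no set of `mixThreshold n` lines separating two faces is monochromatic. -/
theorem Wiring.card_not_mixed_le {n : ℕ} (hn : 1 ≤ n) (w : Wiring n) (hT : w.T ≤ n ^ 2) :
    (Finset.univ.filter fun χ : Fin n → Bool => ¬ w.Mixed χ (mixThreshold n)).card * n ≤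
      32 * 2 ^ n := by
  have h1 := w.card_not_mixed_mul_le (mixThreshold n)
  set c := (Finset.univ.filter fun χ : Fin n → Bool => ¬ w.Mixed χ (mixThreshold n)).card
  have h2 : n ^ 9 ≤ 2 ^ mixThreshold n := by
    rw [mixThreshold, mul_comm, pow_mul]
    exact Nat.pow_le_pow_left (Nat.lt_pow_succ_log_self (by norm_num) n).le 9
  have h3 : (w.T + 1) * (n + 1) ≤ 4 * n ^ 3 := by
    have : w.T + 1 ≤ 2 * n ^ 2 := by nlinarith
    calc _ ≤ (2 * n ^ 2) * (2 * n) := Nat.mul_le_mul this (by omega)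
      _ = _ := by ring
  have h4 : c * n * n ^ 8 ≤ 32 * 2 ^ n * n ^ 6 := by
    calc c * n * n ^ 8 = c * n ^ 9 := by ring
      _ ≤ c * 2 ^ mixThreshold n := Nat.mul_le_mul_left _ h2
      _ ≤ _ := h1
      _ ≤ 2 * (4 * n ^ 3) ^ 2 * 2 ^ n :=
        Nat.mul_le_mul_right _ (Nat.mul_le_mul_left _ (Nat.pow_le_pow_left h3 2))
      _ = _ := by ring
  have h5 : n ^ 6 ≤ n ^ 8 := Nat.pow_le_pow_right hn (by norm_num)
  exact Nat.le_of_mul_le_mul_right (h4.trans (Nat.mul_le_mul_left _ h5)) (by positivity)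

open Classical in
theorem randomColoring_real_setOf (n : ℕ) (p : (Fin n → Bool) → Prop) :
    (randomColoring n).real {χ | p χ} = 1 - (Finset.univ.filter fun χ => ¬ p χ).card / 2 ^ n := by
  have hms : MeasurableSet {χ : Fin n → Bool | p χ} := (Set.toFinite _).measurableSet
  have hc : Fintype.card (Fin n → Bool) = 2 ^ n := by simp
  have h1 : (Finset.univ.filter fun χ => p χ).card + (Finset.univ.filter fun χ => ¬ p χ).card =
      2 ^ n := by
    rw [Finset.card_filter_add_card_filter_not, Finset.card_univ, hc]
  have h2 : ((Finset.univ.filter fun χ => p χ).card : ℝ) =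
      2 ^ n - (Finset.univ.filter fun χ => ¬ p χ).card := by
    rw [eq_sub_iff_add_eq]; exact_mod_cast h1
  have h3 : Fintype.card {χ : Fin n → Bool | p χ} = (Finset.univ.filter fun χ => p χ).card := by
    rw [← Set.toFinset_card]; congr 1; ext; simp
  rw [MeasureTheory.measureReal_def, randomColoring, PMF.toMeasure_uniformOfFintype_apply _ hms,
    h3, hc, ENNReal.toReal_div]
  push_cast
  rw [ENNReal.toReal_natCast, h2, sub_div, ENNReal.toReal_pow]
  simp

/-- The parameters of the snake for large `n`. -/
theorem exists_snake_parameters : ∃ N : ℕ, 33 ≤ N ∧ ∀ n, N ≤ n → ∃ s K base r : ℕ,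
    s = mixThreshold n + 3 ∧ K + 2 * s ≤ base ∧ base + r * (6 * s) + 3 * s ≤ n / 2 ∧
    (1 / 100000 : ℝ) * ((n : ℝ) ^ 2 / Real.log n) ≤ ((r - 1) * K : ℕ) := by
  have hlim : ∀ᶠ n : ℕ in Filter.atTop, Real.log n ≤ 1 / 11904 * (n : ℝ) := by
    have h := (Real.isLittleO_log_id_atTop.comp_tendsto tendsto_natCast_atTop_atTop).bound
      (show (0 : ℝ) < 1 / 11904 by norm_num)
    filter_upwards [h, Filter.eventually_ge_atTop 1] with n hn hn1
    have h0 : 0 ≤ Real.log n := Real.log_natCast_nonneg n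
    simpa [abs_of_nonneg h0] using hn
  obtain ⟨N, hN⟩ := Filter.eventually_atTop.1 hlim
  refine ⟨max N 33, le_max_right _ _, fun n hn => ?_⟩
  have hlog := hN n ((le_max_left _ _).trans hn)
  have hn33 : 33 ≤ n := (le_max_right _ _).trans hn
  have hnR : (33 : ℝ) ≤ n := by exact_mod_cast hn33
  set s := mixThreshold n + 3 with hs
  have hlogpos : 0 < Real.log n := Real.log_pos (by linarith)
  have hsR : (s : ℝ) ≤ 31 * Real.log n := by
    have h1 : 1 ≤ Nat.log 2 n := Nat.log_pos (by norm_num) (by omega)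
    have h2 : (Nat.log 2 n : ℝ) * Real.log 2 ≤ Real.log n := by
      rw [← Real.log_pow]
      apply Real.log_le_log (by positivity)
      exact_mod_cast Nat.pow_log_le_self 2 (by omega)
    have h3 : (s : ℝ) ≤ 21 * Nat.log 2 n := by
      have : s ≤ 21 * Nat.log 2 n := by rw [hs, mixThreshold]; omega
      exact_mod_cast this
    have h4 := Real.log_two_gt_d9
    have h5 : (0 : ℝ) ≤ Nat.log 2 n := Nat.cast_nonneg _
    nlinarith
  set q := n / 8 with hq
  have hqR : (n : ℝ) / 16 ≤ q := by
    have h1 : n ≤ 8 * q + 7 := by omega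
    have h2 : (n : ℝ) ≤ 8 * q + 7 := by exact_mod_cast h1
    linarith
  have hqs : 24 * s ≤ q := by
    have : (24 : ℝ) * s ≤ q := by linarith
    exact_mod_cast this
  have hs0 : 3 ≤ s := by omega
  set r := q / (6 * s) with hr
  have hr1 : r * (6 * s) ≤ q := Nat.div_mul_le_self _ _
  have hr2 : q < (r + 1) * (6 * s) := Nat.lt_mul_of_div_lt (Nat.lt_succ_self _) (by omega)
  refine ⟨s, q, n / 4, r, rfl, by omega, by omega, ?_⟩
  -- `q ≤ 12 s (r - 1)`
  have h1 : q ≤ 12 * s * (r - 1) := by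
    have hr4 : 4 ≤ r := (Nat.le_div_iff_mul_le (by omega)).2 (by omega)
    obtain ⟨a, ha⟩ : ∃ a, r = a + 1 := ⟨r - 1, by omega⟩
    rw [ha] at hr2 ⊢
    simp only [Nat.add_sub_cancel]
    nlinarith
  have h2 : (q : ℝ) ≤ 12 * s * (r - 1 : ℕ) := by exact_mod_cast h1
  have h3 : (n : ℝ) ^ 2 / 256 ≤ q ^ 2 := by
    have := pow_le_pow_left₀ (by positivity) hqR 2
    calc _ = ((n : ℝ) / 16) ^ 2 := by ring
      _ ≤ _ := this
  have h4 : (q : ℝ) ^ 2 ≤ 372 * Real.log n * ((r - 1 : ℕ) * q) := by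
    have h5 : (q : ℝ) ^ 2 ≤ 12 * s * (r - 1 : ℕ) * q := by
      rw [sq]; exact mul_le_mul_of_nonneg_right h2 (Nat.cast_nonneg _)
    have h6 : (12 : ℝ) * s * ((r - 1 : ℕ) * q) ≤ 12 * (31 * Real.log n) * ((r - 1 : ℕ) * q) := by
      gcongr
    calc _ ≤ _ := h5
      _ = 12 * s * ((r - 1 : ℕ) * q) := by ring
      _ ≤ _ := h6
      _ = _ := by ring
  push_cast
  rw [← mul_div_assoc, div_le_iff₀ hlogpos]
  have h7 : 0 ≤ ((r - 1 : ℕ) : ℝ) * q := by positivity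
  nlinarith [mul_nonneg h7 hlogpos.le]

theorem theorem3 :
    ∃ c : ℝ, 0 < c ∧
      (∀ ε : ℝ, 0 < ε → ∃ N : ℕ, ∀ n : ℕ, N ≤ n →
        ∀ A : PseudolineArrangement n, A.IsSimple →
          1 - ε ≤ (randomColoring n).real
            {χ | A.HasAlternatingPath χ (c * ((n : ℝ) ^ 2 / Real.log n))}) ∧
      (∀ n : ℕ, 2 ≤ n → ∀ A : PseudolineArrangement n, A.IsSimple →
        ∃ χ : Fin n → Bool, (∃ i, χ i = true) ∧ (∃ i, χ i = false) ∧
          A.HasAlternatingPath χ (c * ((n : ℝ) ^ 2 / Real.log n))) := by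
  classical
  obtain ⟨N, hN33, hN⟩ := exists_snake_parameters
  have hNpos : (0 : ℝ) < N := by exact_mod_cast (by omega : 0 < N)
  have hlog2 : 0 < Real.log 2 := Real.log_pos (by norm_num)
  set c : ℝ := min (1 / 100000) (Real.log 2 / (N : ℝ) ^ 2) with hc
  -- with the second bound on `c`, a single face suffices for `n < N`
  have hsmall : ∀ n : ℕ, 2 ≤ n → n < N → c * ((n : ℝ) ^ 2 / Real.log n) ≤ 1 := by
    intro n hn hnN
    have hn2 : (2 : ℝ) ≤ n := by exact_mod_cast hn
    have hlogn : Real.log 2 ≤ Real.log n := Real.log_le_log (by norm_num) hn2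
    have hnN' : (n : ℝ) ≤ N := by exact_mod_cast hnN.le
    calc c * ((n : ℝ) ^ 2 / Real.log n)
        ≤ Real.log 2 / (N : ℝ) ^ 2 * ((N : ℝ) ^ 2 / Real.log 2) := by
          gcongr
          exact min_le_right _ _
      _ = 1 := by field_simp
  have hlarge : ∀ n, N ≤ n → ∀ A : PseudolineArrangement n, A.IsSimple →
      ∃ w : Wiring n, w.T ≤ n ^ 2 ∧ ∀ χ, w.Mixed χ (mixThreshold n) →
        A.HasAlternatingPath χ (c * ((n : ℝ) ^ 2 / Real.log n)) := by
    intro n hn A hA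
    obtain ⟨w, x, hgen, hpos, hT⟩ := hA.exists_wiring
    refine ⟨w, hT, fun χ hχ => ?_⟩
    obtain ⟨s, K, base, r, hs, hbase, hr, hle⟩ := hN n hn
    obtain ⟨k, F, hinj, hstep, hk⟩ :=
      hχ.exists_long_path (by unfold mixThreshold; omega) hs hbase hr
    refine (PseudolineArrangement.hasAlternatingPath_of_steps hgen hpos hinj hstep).mono ?_
    have h0 : 0 ≤ (n : ℝ) ^ 2 / Real.log n := by
      have := Real.log_natCast_nonneg n
      positivity
    have h1 : (((r - 1) * K : ℕ) : ℝ) ≤ k := by exact_mod_cast hk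
    have h2 := mul_le_mul_of_nonneg_right (min_le_left _ _ : c ≤ 1 / 100000) h0
    linarith
  refine ⟨c, lt_min (by norm_num) (by positivity), fun ε hε => ?_, fun n hn A hA => ?_⟩
  · obtain ⟨M, hM⟩ := exists_nat_ge (32 / ε)
    refine ⟨max N M, fun n hn A hA => ?_⟩
    obtain ⟨w, hT, hw⟩ := hlarge n ((le_max_left _ _).trans hn) A hA
    have hn33 : 33 ≤ n := hN33.trans ((le_max_left _ _).trans hn)
    have hnpos : (0 : ℝ) < n := by exact_mod_cast (by omega : 0 < n)
    have hMn : (M : ℝ) ≤ n := by exact_mod_cast (le_max_right _ _).trans hn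
    rw [randomColoring_real_setOf]
    have hsub : (Finset.univ.filter fun χ =>
        ¬ A.HasAlternatingPath χ (c * ((n : ℝ) ^ 2 / Real.log n))) ⊆
        Finset.univ.filter fun χ => ¬ w.Mixed χ (mixThreshold n) := by
      intro χ
      simp only [Finset.mem_filter, Finset.mem_univ, true_and]
      exact mt (hw χ)
    have h1 := (Nat.mul_le_mul_right n (Finset.card_le_card hsub)).trans
      (w.card_not_mixed_le (by omega) hT)
    have h2 : ((Finset.univ.filter fun χ =>
        ¬ A.HasAlternatingPath χ (c * ((n : ℝ) ^ 2 / Real.log n))).card : ℝ) * n ≤ 32 * 2 ^ n := by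
      exact_mod_cast h1
    have h3 : 32 ≤ ε * n := by
      rw [div_le_iff₀ hε] at hM
      nlinarith
    have h4 : ((Finset.univ.filter fun χ =>
        ¬ A.HasAlternatingPath χ (c * ((n : ℝ) ^ 2 / Real.log n))).card : ℝ) / 2 ^ n ≤ ε := by
      rw [div_le_iff₀ (by positivity)]
      refine le_of_mul_le_mul_right (h2.trans ?_) hnpos
      have : (0 : ℝ) < 2 ^ n := by positivity
      nlinarith
    linarith
  · rcases lt_or_ge n N with hnN | hnN
    · exact ⟨fun i => decide (i = ⟨0, by omega⟩), ⟨⟨0, by omega⟩, by simp⟩,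
        ⟨⟨1, by omega⟩, by simp⟩, A.hasAlternatingPath_of_le_one _ (hsmall n hn hnN)⟩
    · obtain ⟨w, hT, hw⟩ := hlarge n hnN A hA
      obtain ⟨χ, hχ⟩ : ∃ χ, w.Mixed χ (mixThreshold n) := by
        by_contra hcon
        push Not at hcon
        have h1 := w.card_not_mixed_le (by omega) hT
        rw [Finset.filter_true_of_mem fun χ _ => hcon χ, Finset.card_univ, Fintype.card_fun,
          Fintype.card_bool, Fintype.card_fin, mul_comm] at h1
        have := Nat.le_of_mul_le_mul_right h1 (by positivity)
        omega
      obtain ⟨s, K, base, r, hs, hbase, hr, -⟩ := hN n hnN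
      obtain ⟨g, -, -, i, j, -, -, hij⟩ := hχ.exists_isBi (by unfold mixThreshold; omega) 0
        (k := 0) (by omega)
      refine ⟨χ, ?_, ?_, hw χ hχ⟩
      · cases hi : χ i
        · exact ⟨j, by rw [hi] at hij; revert hij; cases χ j <;> simp⟩
        · exact ⟨i, hi⟩
      · cases hi : χ i
        · exact ⟨i, hi⟩
        · exact ⟨j, by rw [hi] at hij; revert hij; cases χ j <;> simp⟩
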